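/- Let $n,m\ge 1$ and let $\mathbb F_n^+$ be the free semigroup (with identity $g_0$) on $g_1,\dots,g_n$. For $X=(X_1,\dots,X_n)\in B(\mathcal H)^n$ write $X_\alpha=X_{i_1}\cdots X_{i_k}$ if $\alpha=g_{i_1}\cdots g_{i_k}$, and $X_{g_0}=I$. Let $f=\sum_{\alpha}a_\alpha X_\alpha$ be a positive regular free holomorphic function on $[B(\mathcal H)^n]_\rho=\{X:\|\sum_i X_iX_i^*\|<\rho\}$ for some $\rho>0$, i.e. $a_\alpha\ge 0$, $a_{g_0}=0$, $a_{g_i}>0$ for $i=1,\dots,n$, and $\sum_{k}\sum_{|\alpha|=k}a_\alpha X_\alpha$ converges in norm for all $X\in[B(\mathcal H)^n]_\rho$. Put $\Phi_{f,X}(Y)=\sum_{|\alpha|\ge1}a_\alpha X_\alpha YX_\alpha^*$ (weak operator convergence), and let $\mathbf D_f^m(\mathcal H)$ be the set of $X\in B(\mathcal H)^n$ for which $\sum_{|\alpha|\geq 1} a_\alpha X_\alpha X_\alpha^*$ converges weakly and $(\mathrm{id}-\Phi_{f,X})^k(I)\ge0$ for $1\le k\le m$. For a set $\mathcal Q$ of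 noncommutative polynomials in $n$ indeterminates put $\mathcal V^m_{f,\mathcal Q}(\mathcal H)=\{X\in\mathbf D_f^m(\mathcal H): q(X)=0\text{ for all }q\in\mathcal Q\}$. Let $b_{g_0}=1$ and, for $|\alpha|\ge1$, $b_\alpha=\sum_{j=1}^{|\alpha|}\binom{j+m-1}{m-1}\sum_{\gamma_1\cdots\gamma_j=\alpha,\ |\gamma_i|\ge1}a_{\gamma_1}\cdots a_{\gamma_j}$. On the full Fock space $F^2(H_n)$, with orthonormal basis $\{e_\alpha\}_{\alpha\in\mathbb F_n^+}$ and $1=e_{g_0}$, let $W_ie_\alpha=\sqrt{b_\alpha/b_{g_i\alpha}}\,e_{g_i\alpha}$. Let $\mathcal M_{\mathcal Q}=\overline{\mathrm{span}}\{W_\alpha q(W_1,\dots,W_n)W_\beta 1:\ q\in\mathcal Q,\ \alpha,\beta\in\mathbb F_n^+\}$, $\mathcal N_{\mathcal Q}=F^2(H_n)\ominus\mathcal M_{\mathcal Q}$ and $B_i=P_{\mathcal N_{\mathcal Q}}W_i|_{\mathcal N_{\mathcal Q}}$. Assume $\mathcal N_{\mathcal Q}\ne\{0\}$. **Theorem.**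 Let $\mathcal H$ be a complex Hilbert space, $T=(T_1,\dots,T_n)\in\mathcal V^m_{f,\mathcal Q}(\mathcal H)$, $\Delta_{f,m,T}=[(\mathrm{id}-\Phi_{f,T})^m(I)]^{1/2}$ and $\mathcal D=\overline{\Delta_{f,m,T}\mathcal H}$. Then there exist a Hilbert space $\mathcal K$ and $U=(U_1,\dots,U_n)\in\mathcal V^m_{f,\mathcal Q}(\mathcal K)$ with $\Phi_{f,U}(I_{\mathcal K})=I_{\mathcal K}$ such that: (i) $\mathcal H$ can be identified, through a linear isometry, with a subspace of $\widetilde{\mathcal K}=(\mathcal N_{\mathcal Q}\otimes\mathcal D)\oplus\mathcal K$ that is co-invariant under the operators $V_i=(B_i\otimes I_{\mathcal D})\oplus U_i$, i.e. invariant under $V_i^*$, $i=1,\dots,n$; (ii) under this identification $T_i^*=V_i^*|_{\mathcal H}$ for $i=1,\dots,n$. Moreover, this $\mathcal K$ is $\{0\}$ if and only if $T$ is pure, i.e. $\Phi_{f,T}^k(I)\to0$ strongly as $k\to\infty$. -/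

import Mathlib

open scoped TensorProduct InnerProductSpace
open Filter Topology

universe u

noncomputable section

namespace NCVariety

/-! ### Words, monomials and polynomials

The free semigroup on `n` generators is `FreeMonoid (Fin n)`; noncommutative polynomials in `n`
indeterminates are the elements of `FreeAlgebra ℂ (Fin n)`. -/

section Monomials

variable {n : ℕ} {H : Type*} [NormedAddCommGroup H] [InnerProductSpace ℂ H]

/-- The monomial `X_α = X_{i₁} ⋯ X_{i_k}` for the word `α = g_{i₁} ⋯ g_{i_k}`. -/
def monomial (X : Fin n → H →L[ℂ] H) (α : FreeMonoid (Fin n)) : H →L[ℂ] H :=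
  FreeMonoid.lift X α

/-- The value `q(X₁, …, Xₙ)` of a noncommutative polynomial. -/
def polyEval (X : Fin n → H →L[ℂ] H) (q : FreeAlgebra ℂ (Fin n)) : H →L[ℂ] H :=
  FreeAlgebra.lift ℂ X q

end Monomials

/-! ### Positive regular free holomorphic functions -/

/-- A formal power series `f = ∑ a_α X_α` in `n` noncommuting indeterminates whose coefficients
satisfy the positive regularity conditions. Convergence is `IsFreeHolomorphicOn`. -/
structure PosRegular (n : ℕ) where
  /-- the coefficients `a_α` -/
  coeff : FreeMonoid (Fin n) → ℝ
  coeff_nonneg : ∀ α, 0 ≤ coeff α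
  coeff_one : coeff 1 = 0
  coeff_of_pos : ∀ i, 0 < coeff (FreeMonoid.of i)

namespace PosRegular

variable {n : ℕ} (f : PosRegular n)

/-- `f` is free holomorphic on the ball `{X ∈ B(H)ⁿ : ‖∑ X_i X_i^*‖ < ρ}`: for every `X` in it the
series `∑_k ∑_{|α| = k} a_α X_α` converges in the operator norm. The words of length `k` are listed
as functions `Fin k → Fin n`. -/
def IsFreeHolomorphicOn (H : Type*) [NormedAddCommGroup H] [InnerProductSpace ℂ H]
    [CompleteSpace H] (ρ : ℝ) : Prop :=
  ∀ X : Fin n → H →L[ℂ] H, ‖∑ i, X i * star (X i)‖ < ρ →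
    ∃ S : H →L[ℂ] H, Tendsto
      (fun N : ℕ => ∑ k ∈ Finset.range N, ∑ w : Fin k → Fin n,
        (f.coeff (FreeMonoid.ofList (List.ofFn w)) : ℂ) •
          monomial X (FreeMonoid.ofList (List.ofFn w)))
      atTop (𝓝 S)

/-- The summand of `b_α^{(m)}` that belongs to the factorization `α = γ₁ ⋯ γ_j` into nonempty words
which is given by the composition `c` of `|α|`. -/
def bTerm (m : ℕ) (l : List (Fin n)) (c : Composition l.length) : ℝ :=
  ((l.splitWrtComposition c).map fun γ => f.coeff (FreeMonoid.ofList γ)).prod *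
    ((c.length + m - 1).choose (m - 1) : ℝ)

/-- `b_α^{(m)} = ∑_j ∑_{γ₁ ⋯ γ_j = α, |γ_i| ≥ 1} a_{γ₁} ⋯ a_{γ_j} * (j + m - 1).choose (m - 1)`.
For the empty word there is just the empty factorization, and the value is `1`. -/
def b (m : ℕ) (α : FreeMonoid (Fin n)) : ℝ :=
  ∑ c : Composition α.toList.length, f.bTerm m α.toList c

lemma bTerm_nonneg (m : ℕ) (l : List (Fin n)) (c : Composition l.length) :
    0 ≤ f.bTerm m l c := by
  refine mul_nonneg (List.prod_nonneg ?_) (Nat.cast_nonneg _)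
  intro x hx
  obtain ⟨γ, -, rfl⟩ := List.mem_map.1 hx
  exact f.coeff_nonneg _

/-- Prepending a block of size `1` to a composition. -/
def consOne {k : ℕ} : Composition k ↪ Composition (k + 1) where
  toFun c := ⟨1 :: c.blocks, by
    intro i hi
    rcases List.mem_cons.1 hi with rfl | hi
    · exact one_pos
    · exact c.blocks_pos hi, by rw [List.sum_cons, c.blocks_sum, add_comm]⟩
  inj' c d h := by
    have := congrArg Composition.blocks h
    exact Composition.ext (List.cons.inj this).2

lemma coeff_mul_b_le (m : ℕ) (i : Fin n) (α : FreeMonoid (Fin n)) :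
    f.coeff (FreeMonoid.of i) * f.b m α ≤ f.b m (FreeMonoid.of i * α) := by
  have h1 : f.coeff (FreeMonoid.of i) * f.b m α ≤
      ∑ c : Composition α.toList.length, f.bTerm m (i :: α.toList) (consOne c) := by
    unfold b
    rw [Finset.mul_sum]
    refine Finset.sum_le_sum fun c _ => ?_
    have hs : (i :: α.toList).splitWrtComposition (consOne c) =
        [i] :: α.toList.splitWrtComposition c := by
      change (i :: α.toList).splitWrtCompositionAux (1 :: c.blocks) = _
      simp [List.splitWrtComposition, List.splitWrtCompositionAux_cons]
    have hl : (consOne c).length = c.length + 1 := rfl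
    unfold bTerm
    rw [hs, hl, List.map_cons, List.prod_cons, mul_assoc]
    refine mul_le_mul_of_nonneg_left ?_ (f.coeff_nonneg _)
    refine mul_le_mul_of_nonneg_left ?_ (List.prod_nonneg ?_)
    · exact_mod_cast Nat.choose_le_choose _ (by omega)
    · intro x hx
      obtain ⟨γ, -, rfl⟩ := List.mem_map.1 hx
      exact f.coeff_nonneg _
  refine h1.trans ?_
  rw [← Finset.sum_map Finset.univ consOne (fun c => f.bTerm m (i :: α.toList) c)]
  exact Finset.sum_le_univ_sum_of_nonneg fun c => f.bTerm_nonneg m (i :: α.toList) c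

lemma b_one (m : ℕ) : f.b m 1 = 1 := by
  have : ∀ c : Composition ([] : List (Fin n)).length, f.bTerm m [] c = 1 := by
    intro c
    have hb : c.blocks = [] := by
      by_contra hne
      obtain ⟨x, hx⟩ := List.exists_mem_of_ne_nil _ hne
      have h1 := c.blocks_pos hx
      have h2 := List.le_sum_of_mem hx
      rw [c.blocks_sum] at h2
      simp at h2
      omega
    simp [bTerm, List.splitWrtComposition, List.splitWrtCompositionAux, Composition.length, hb]
  change ∑ c : Composition ([] : List (Fin n)).length, f.bTerm m [] c = 1
  rw [Finset.sum_congr rfl fun c _ => this c]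
  have hc : Fintype.card (Composition ([] : List (Fin n)).length) = 1 := by
    rw [composition_card]; simp
  simp only [Finset.sum_const, Finset.card_univ, hc, one_smul]

lemma b_pos (m : ℕ) (α : FreeMonoid (Fin n)) : 0 < f.b m α := by
  induction α using FreeMonoid.recOn with
  | one => rw [b_one]; exact one_pos
  | of_mul i α h =>
    exact lt_of_lt_of_le (mul_pos (f.coeff_of_pos i) h) (f.coeff_mul_b_le m i α)

end PosRegular

/-! ### The full Fock space and the weighted left creation operators -/

/-- The full Fock space `F²(Hₙ)`, written in its orthonormal basis `(e_α)` indexed by the words. -/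
abbrev Fock (n : ℕ) : Type := lp (fun _ : FreeMonoid (Fin n) => ℂ) 2

instance (n : ℕ) : DecidableEq (FreeMonoid (Fin n)) :=
  inferInstanceAs (DecidableEq (List (Fin n)))

/-- The vacuum vector `1 = e_{g₀}`. -/
def vacuum (n : ℕ) : Fock n := lp.single 2 1 1

namespace PosRegular

variable {n : ℕ} (f : PosRegular n)

/-- The weight `√(b_γ / b_{g_i γ})`. -/
def weight (m : ℕ) (i : Fin n) (γ : FreeMonoid (Fin n)) : ℝ :=
  √(f.b m γ / f.b m (FreeMonoid.of i * γ))

lemma weight_sq_le (m : ℕ) (i : Fin n) (γ : FreeMonoid (Fin n)) :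
    f.weight m i γ ^ 2 ≤ (f.coeff (FreeMonoid.of i))⁻¹ := by
  unfold weight
  rw [Real.sq_sqrt (div_nonneg (f.b_pos m _).le (f.b_pos m _).le),
    div_le_iff₀ (f.b_pos m _), inv_mul_eq_div, le_div_iff₀ (f.coeff_of_pos i), mul_comm]
  exact f.coeff_mul_b_le m i γ

/-- The coordinates of `W_i x`: `√(b_γ / b_{g_i γ}) x_γ` at the word `g_i γ`, and `0` at the words
that do not start with `g_i`. -/
def shiftFun (m : ℕ) (i : Fin n) (x : FreeMonoid (Fin n) → ℂ) : FreeMonoid (Fin n) → ℂ :=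
  Function.extend (fun γ => FreeMonoid.of i * γ) (fun γ => (f.weight m i γ : ℂ) * x γ) 0

lemma hasSum_shiftFun (m : ℕ) (i : Fin n) (x : Fock n) :
    ∃ s, HasSum (fun α => ‖f.shiftFun m i x α‖ ^ 2) s ∧
      s ≤ (f.coeff (FreeMonoid.of i))⁻¹ * ‖x‖ ^ 2 := by
  have hx : HasSum (fun γ => ‖x γ‖ ^ 2) (‖x‖ ^ 2) := by
    have := lp.hasSum_norm (p := 2) (by norm_num) x
    simpa using this
  have hle : ∀ γ, ‖(f.weight m i γ : ℂ) * x γ‖ ^ 2 ≤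
      (f.coeff (FreeMonoid.of i))⁻¹ * ‖x γ‖ ^ 2 := by
    intro γ
    rw [norm_mul, mul_pow, Complex.norm_real, Real.norm_eq_abs, sq_abs]
    exact mul_le_mul_of_nonneg_right (f.weight_sq_le m i γ) (sq_nonneg _)
  have hinj : Function.Injective (fun γ => FreeMonoid.of i * γ) := mul_right_injective _
  have hsum : Summable fun γ => ‖(f.weight m i γ : ℂ) * x γ‖ ^ 2 :=
    Summable.of_nonneg_of_le (fun _ => sq_nonneg _) hle (hx.summable.mul_left _)
  refine ⟨∑' γ, ‖(f.weight m i γ : ℂ) * x γ‖ ^ 2, ?_,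
    hasSum_le hle hsum.hasSum (hx.mul_left _)⟩
  rw [← Function.Injective.hasSum_iff hinj]
  · convert hsum.hasSum using 2 with γ
    simp [shiftFun, hinj.extend_apply]
  · intro α hα
    have : ¬∃ γ, FreeMonoid.of i * γ = α := fun ⟨γ, h⟩ => hα ⟨γ, h⟩
    simp [shiftFun, Function.extend_apply' _ _ _ this]

lemma memℓp_shiftFun (m : ℕ) (i : Fin n) (x : Fock n) :
    Memℓp (f.shiftFun m i x) 2 := by
  obtain ⟨s, hs, -⟩ := f.hasSum_shiftFun m i x
  refine memℓp_gen ?_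
  simpa using hs.summable

/-- The weighted left creation operator `W_i`, with
`W_i e_α = √(b_α^{(m)} / b_{g_i α}^{(m)}) e_{g_i α}`. -/
def W (m : ℕ) (i : Fin n) : Fock n →L[ℂ] Fock n :=
  LinearMap.mkContinuous
    { toFun := fun x => ⟨f.shiftFun m i x, f.memℓp_shiftFun m i x⟩
      map_add' := fun x y => by
        ext α
        change f.shiftFun m i (x + y : Fock n) α = f.shiftFun m i x α + f.shiftFun m i y α
        by_cases h : ∃ γ, FreeMonoid.of i * γ = α
        · obtain ⟨γ, rfl⟩ := h
          simp [shiftFun, (mul_right_injective (FreeMonoid.of i)).extend_apply, mul_add]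
        · simp [shiftFun, Function.extend_apply' _ _ _ h]
      map_smul' := fun c x => by
        ext α
        by_cases h : ∃ γ, FreeMonoid.of i * γ = α
        · obtain ⟨γ, rfl⟩ := h
          simp [shiftFun, (mul_right_injective (FreeMonoid.of i)).extend_apply, mul_left_comm]
        · simp [shiftFun, Function.extend_apply' _ _ _ h] }
    (√(f.coeff (FreeMonoid.of i))⁻¹) (fun x => by
      obtain ⟨s, hs, hle⟩ := f.hasSum_shiftFun m i x
      have h0 := inv_nonneg.2 (f.coeff_nonneg (FreeMonoid.of i))
      refine le_of_sq_le_sq ?_ (mul_nonneg (Real.sqrt_nonneg _) (norm_nonneg _))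
      rw [mul_pow, Real.sq_sqrt h0]
      refine le_trans (le_of_eq ?_) hle
      have h := lp.hasSum_norm (p := 2) (by norm_num)
        (⟨f.shiftFun m i x, f.memℓp_shiftFun m i x⟩ : Fock n)
      refine HasSum.unique ?_ hs
      simpa using h)

/-- `M_Q`: the closed span of the vectors `W_α q(W₁, …, Wₙ) W_β (1)`. -/
def MQ (m : ℕ) (Q : Set (FreeAlgebra ℂ (Fin n))) : Submodule ℂ (Fock n) :=
  (Submodule.span ℂ {v | ∃ q ∈ Q, ∃ α β : FreeMonoid (Fin n),
    v = monomial (f.W m) α (polyEval (f.W m) q (monomial (f.W m) β (vacuum n)))}).topologicalClosure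

/-- `N_Q = F²(Hₙ) ⊖ M_Q`. -/
def NQ (m : ℕ) (Q : Set (FreeAlgebra ℂ (Fin n))) : Submodule ℂ (Fock n) := (f.MQ m Q)ᗮ

instance (m : ℕ) (Q : Set (FreeAlgebra ℂ (Fin n))) : CompleteSpace (f.NQ m Q) :=
  inferInstanceAs (CompleteSpace ((f.MQ m Q)ᗮ : Submodule ℂ (Fock n)))

/-- The constrained weighted shift `B_i = P_{N_Q} W_i |_{N_Q}`. -/
def B (m : ℕ) (Q : Set (FreeAlgebra ℂ (Fin n))) (i : Fin n) : f.NQ m Q →L[ℂ] f.NQ m Q :=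
  (f.NQ m Q).orthogonalProjectionOnto ∘L f.W m i ∘L (f.NQ m Q).subtypeL

/-! ### The map `Φ_{f,X}`, noncommutative domains and varieties -/

section Domain

variable {H : Type*} [NormedAddCommGroup H] [InnerProductSpace ℂ H] [CompleteSpace H]

/-- The term `a_α X_α Y X_α^*` as an element of `B(H)` with the weak operator topology. -/
def PhiTerm (X : Fin n → H →L[ℂ] H) (Y : H →L[ℂ] H) (α : FreeMonoid (Fin n)) : H →WOT[ℂ] H :=
  .ofCLM ((f.coeff α : ℂ) • (monomial X α * Y * star (monomial X α)))

/-- `Φ_{f,X}(Y) = ∑_α a_α X_α Y X_α^*`, the sum being taken in the weak operator topology. (The empty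
word contributes nothing, its coefficient being `0`.) Where it is used, the sum converges for
`Y = I`, and hence for every `Y`. -/
def Phi (X : Fin n → H →L[ℂ] H) (Y : H →L[ℂ] H) : H →L[ℂ] H :=
  (∑' α, f.PhiTerm X Y α).toCLM

/-- `(id - Φ_{f,X})^k (I)`. -/
def defect (X : Fin n → H →L[ℂ] H) (k : ℕ) : H →L[ℂ] H :=
  (fun Y => Y - f.Phi X Y)^[k] 1

/-- The noncommutative domain `D_f^m(H)`. -/
def domain (m : ℕ) (H : Type*) [NormedAddCommGroup H] [InnerProductSpace ℂ H] [CompleteSpace H] :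
    Set (Fin n → H →L[ℂ] H) :=
  {X | Summable (f.PhiTerm X 1) ∧ ∀ k, 1 ≤ k → k ≤ m → 0 ≤ f.defect X k}

/-- The noncommutative variety `V_{f,Q}^m(H)`. -/
def variety (m : ℕ) (Q : Set (FreeAlgebra ℂ (Fin n)))
    (H : Type*) [NormedAddCommGroup H] [InnerProductSpace ℂ H] [CompleteSpace H] :
    Set (Fin n → H →L[ℂ] H) :=
  {X | X ∈ f.domain m H ∧ ∀ q ∈ Q, polyEval X q = 0}

/-- `X` is pure: `Φ_{f,X}^k(I) → 0` strongly as `k → ∞`. -/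
def IsPure (X : Fin n → H →L[ℂ] H) : Prop :=
  ∀ h : H, Tendsto (fun k : ℕ => ((f.Phi X)^[k] 1) h) atTop (𝓝 0)

/-- `Δ_{f,m,X} = [(id - Φ_{f,X})^m (I)]^{1/2}`. -/
def Delta (m : ℕ) (X : Fin n → H →L[ℂ] H) : H →L[ℂ] H := CFC.sqrt (f.defect X m)

/-- The closure of the range of `Δ_{f,m,X}`. -/
def defectSpace (m : ℕ) (X : Fin n → H →L[ℂ] H) : Submodule ℂ H :=
  (LinearMap.range (f.Delta m X : H →ₗ[ℂ] H)).topologicalClosure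

end Domain

end PosRegular

/-! ### Hilbert space tensor products and direct sums -/

/-- The Hilbert space tensor product. -/
abbrev HilbertTensor (E F : Type*) [NormedAddCommGroup E] [InnerProductSpace ℂ E]
    [NormedAddCommGroup F] [InnerProductSpace ℂ F] : Type _ :=
  UniformSpace.Completion (E ⊗[ℂ] F)

/-- The operator `A ⊗ I_F` on the Hilbert space tensor product. -/
def ampliation {E : Type*} (F : Type*) [NormedAddCommGroup E] [InnerProductSpace ℂ E]
    [NormedAddCommGroup F] [InnerProductSpace ℂ F] (A : E →L[ℂ] E) :
    HilbertTensor E F →L[ℂ] HilbertTensor E F :=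
  (A.rTensor F).completion

/-- The operator `A ⊕ U` on the Hilbert space direct sum `E ⊕ K`. -/
def directSum {E K : Type*} [NormedAddCommGroup E] [InnerProductSpace ℂ E]
    [NormedAddCommGroup K] [InnerProductSpace ℂ K] (A : E →L[ℂ] E) (U : K →L[ℂ] K) :
    WithLp 2 (E × K) →L[ℂ] WithLp 2 (E × K) :=
  ((WithLp.prodContinuousLinearEquiv 2 ℂ E K).symm : E × K →L[ℂ] WithLp 2 (E × K)) ∘L
    A.prodMap U ∘L (WithLp.prodContinuousLinearEquiv 2 ℂ E K : WithLp 2 (E × K) →L[ℂ] E × K)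

namespace PosRegular

variable {n : ℕ} (f : PosRegular n) {H : Type*} [NormedAddCommGroup H] [InnerProductSpace ℂ H]
  [CompleteSpace H]

/-- The space `(N_Q ⊗ closure (Δ_{f,m,T} H)) ⊕ K`. -/
abbrev DilationSpace (m : ℕ) (Q : Set (FreeAlgebra ℂ (Fin n))) (T : Fin n → H →L[ℂ] H)
    (K : Type*) [NormedAddCommGroup K] [InnerProductSpace ℂ K] : Type _ :=
  WithLp 2 (HilbertTensor (f.NQ m Q) (f.defectSpace m T) × K)

/-- The operators `V_i = (B_i ⊗ I) ⊕ U_i`. -/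
def dilation (m : ℕ) (Q : Set (FreeAlgebra ℂ (Fin n))) (T : Fin n → H →L[ℂ] H)
    {K : Type*} [NormedAddCommGroup K] [InnerProductSpace ℂ K] (U : Fin n → K →L[ℂ] K)
    (i : Fin n) : f.DilationSpace m Q T K →L[ℂ] f.DilationSpace m Q T K :=
  directSum (ampliation (f.defectSpace m T) (f.B m Q i)) (U i)

end PosRegular

end NCVariety

end

/-! Write Φ for `Phi T` and `Δ² = (id - Φ)^m(I)`. Since `m ≥ 1`, `Φ(I) ≤ I`, so the powers `Φ^k(I)`
decrease weakly to some `S ≥ 0` with `Φ(S) = S` (`exists_asymptotic_limit`). The space `H` then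
splits isometrically according to `I = (I - S) + S`.

The summand `S`: factor `S = Y^* Y` with `Y : H → K` of dense range. The fixed point equation reads
`∑ a_α ‖Y T_α^* h‖² = ‖Y h‖²`; as `a_{g_i} > 0`, the map `Y h ↦ Y T_i^* h` is bounded and extends to
an operator `U_i^*` on `K`. The same equation says `Φ_{f,U}(I) = I`, and `q(U) = 0` follows from
`Y^* q(U) = q(T) Y^*` with `Y^*` injective (`exists_unital_part`, `exists_residual_part`).

The summand `I - S`: in analogy with the expansion of `(1 - x)^{-m}`, one has `∑_k (k+m-1).choose
(m-1) Φ^k(Δ²) = I - S`. Expanding `Φ^k` over words turns the left side into `∑_α b_α T_α Δ² T_α^*`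
(`tsum_b_mul_wordForm`). Hence the Poisson kernel `h ↦ ∑ √b_α e_α ⊗ Δ T_α^* h` has squared norm
`‖h‖² - ⟪h, S h⟫`. It intertwines `T_i^*` with `W_i^* ⊗ I`, and `q(T) = 0` forces its range into
`N_Q ⊗ D` (`exists_constrained_poissonKernel`).

The pair (Poisson kernel, `Y`) is the required isometry. Finally `K = 0` iff `S = 0`, which is
purity, because positive contractions that tend weakly to `0` tend strongly to `0`. -/

noncomputable section

namespace NCVariety

/-! ### Quadratic forms and weak operator limits -/

section Weak

variable {H : Type*} [NormedAddCommGroup H] [InnerProductSpace ℂ H]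

open scoped ComplexOrder in
theorem nonneg_iff_inner {A : H →L[ℂ] H} : 0 ≤ A ↔ ∀ h, 0 ≤ ⟪h, A h⟫_ℂ := by
  rw [ContinuousLinearMap.nonneg_iff_isPositive]
  refine ⟨fun hA h => hA.inner_nonneg_right h, fun hA => ?_⟩
  rw [ContinuousLinearMap.isPositive_iff_complex]
  intro x
  have h1 := hA x
  rw [← inner_conj_symm, starRingEnd_apply, star_nonneg_iff] at h1
  exact ⟨Complex.ext rfl (Complex.nonneg_iff.1 h1).2, (Complex.nonneg_iff.1 h1).1⟩

theorem inner_self_eq_ofReal_re {A : H →L[ℂ] H} (hA : 0 ≤ A) (h : H) :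
    ⟪h, A h⟫_ℂ = ((⟪h, A h⟫_ℂ).re : ℂ) :=
  Complex.ext rfl (Complex.nonneg_iff.1 (nonneg_iff_inner.1 hA h)).2.symm

theorem re_inner_nonneg {A : H →L[ℂ] H} (hA : 0 ≤ A) (h : H) : 0 ≤ (⟪h, A h⟫_ℂ).re :=
  (Complex.nonneg_iff.1 (nonneg_iff_inner.1 hA h)).1

/-- Polarization over `ℂ`. Operator identities for weakly convergent sums can thus be checked on
quadratic forms. -/
theorem eq_of_inner_self_eq {A B : H →L[ℂ] H} (hAB : ∀ h, ⟪h, A h⟫_ℂ = ⟪h, B h⟫_ℂ) : A = B := by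
  have h1 : (A : H →ₗ[ℂ] H) = B := by
    rw [← ext_inner_map]
    intro x
    rw [← inner_conj_symm, ← inner_conj_symm (B.toLinearMap x)]
    exact congrArg _ (hAB x)
  exact ContinuousLinearMap.coe_injective h1

variable [CompleteSpace H]

/-- A uniformly bounded family of operators whose matrix coefficients all converge has a weak
limit. -/
theorem exists_weak_limit {ι : Type*} {l : Filter ι} [l.NeBot] (A : ι → H →L[ℂ] H) (C : ℝ)
    (hC : ∀ i g h, ‖⟪g, A i h⟫_ℂ‖ ≤ C * ‖g‖ * ‖h‖)
    (hlim : ∀ g h, ∃ z, Tendsto (fun i => ⟪g, A i h⟫_ℂ) l (𝓝 z)) :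
    ∃ S : H →L[ℂ] H, ∀ g h, Tendsto (fun i => ⟪g, A i h⟫_ℂ) l (𝓝 ⟪g, S h⟫_ℂ) := by
  choose z hz using hlim
  -- The limits form a bounded sesquilinear form, which the Riesz theorem represents by an operator.
  let B : H →L⋆[ℂ] H →L[ℂ] ℂ := LinearMap.mkContinuous₂
    (LinearMap.mk₂'ₛₗ (starRingEnd ℂ) (RingHom.id ℂ) z
      (fun g g' h => tendsto_nhds_unique (hz _ _)
        (by simpa only [inner_add_left] using (hz g h).add (hz g' h)))
      (fun c g h => tendsto_nhds_unique (hz _ _)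
        (by simpa only [inner_smul_left, smul_eq_mul] using (hz g h).const_mul _))
      (fun g h h' => tendsto_nhds_unique (hz _ _)
        (by simpa only [map_add, inner_add_right] using (hz g h).add (hz g h')))
      (fun c g h => tendsto_nhds_unique (hz _ _)
        (by simpa only [map_smul, inner_smul_right, smul_eq_mul, RingHom.id_apply]
              using (hz g h).const_mul _))) C
    (fun g h => le_of_tendsto (hz g h).norm (Eventually.of_forall fun i => hC i g h))
  refine ⟨ContinuousLinearMap.adjoint (InnerProductSpace.continuousLinearMapOfBilin B),
    fun g h => ?_⟩
  rw [ContinuousLinearMap.adjoint_inner_right,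
    InnerProductSpace.continuousLinearMapOfBilin_apply]
  exact hz g h

theorem hasSum_wot_iff {ι : Type*} {A : ι → H →WOT[ℂ] H} {S : H →WOT[ℂ] H} :
    HasSum A S ↔ ∀ g h, HasSum (fun i => ⟪g, A i h⟫_ℂ) ⟪g, S h⟫_ℂ := by
  have hsum : ∀ (F : Finset ι) (h : H), (∑ i ∈ F, A i) h = ∑ i ∈ F, A i h := by
    intro F h
    induction F using Finset.cons_induction with
    | empty => simp
    | cons a s ha ih => simp [Finset.sum_cons, ih]
  unfold HasSum
  rw [ContinuousLinearMapWOT.tendsto_iff_forall_inner_apply_tendsto]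
  simp only [hsum, inner_sum]
  exact forall_comm

end Weak

/-! ### Maps intertwining two tuples of operators -/

section Intertwining

variable {n : ℕ} {E F : Type*} [NormedAddCommGroup E] [InnerProductSpace ℂ E]
  [NormedAddCommGroup F] [InnerProductSpace ℂ F]

@[simp] theorem monomial_one (X : Fin n → E →L[ℂ] E) : monomial X 1 = 1 := map_one _

@[simp] theorem monomial_of (X : Fin n → E →L[ℂ] E) (i : Fin n) :
    monomial X (FreeMonoid.of i) = X i := FreeMonoid.lift_eval_of _ _

theorem monomial_mul (X : Fin n → E →L[ℂ] E) (α β : FreeMonoid (Fin n)) :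
    monomial X (α * β) = monomial X α * monomial X β := map_mul _ _ _

theorem intertwine_monomial {X : Fin n → E →L[ℂ] E} {Z : Fin n → F →L[ℂ] F} (G : E →L[ℂ] F)
    (hG : ∀ i v, G (X i v) = Z i (G v)) (α : FreeMonoid (Fin n)) (v : E) :
    G (monomial X α v) = monomial Z α (G v) := by
  induction α using FreeMonoid.recOn generalizing v with
  | one => simp
  | of_mul i α ih => simp [monomial_mul, hG, ih]

theorem intertwine_polyEval {X : Fin n → E →L[ℂ] E} {Z : Fin n → F →L[ℂ] F} (G : E →L[ℂ] F)
    (hG : ∀ i v, G (X i v) = Z i (G v)) (q : FreeAlgebra ℂ (Fin n)) (v : E) :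
    G (polyEval X q v) = polyEval Z q (G v) := by
  unfold polyEval
  induction q using FreeAlgebra.induction generalizing v with
  | grade0 r => simp [Algebra.algebraMap_eq_smul_one]
  | grade1 i => simp [hG]
  | mul a b ha hb => simp [ha, hb]
  | add a b ha hb => simp [ha, hb]

end Intertwining

/-! ### The positive map Φ -/

namespace PosRegular

variable {n : ℕ} (f : PosRegular n) {H : Type*} [NormedAddCommGroup H] [InnerProductSpace ℂ H]
  [CompleteSpace H] {X : Fin n → H →L[ℂ] H}

open ContinuousLinearMap (adjoint)

theorem inner_PhiTerm (X : Fin n → H →L[ℂ] H) (Y : H →L[ℂ] H) (α : FreeMonoid (Fin n)) (g h : H) :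
    ⟪g, f.PhiTerm X Y α h⟫_ℂ =
      f.coeff α * ⟪adjoint (monomial X α) g, Y (adjoint (monomial X α) h)⟫_ℂ := by
  rw [ContinuousLinearMap.adjoint_inner_left]
  simp [PhiTerm, ContinuousLinearMap.star_eq_adjoint]

/-- Cauchy–Schwarz with `c h α = √a_α ‖X_α^* h‖` dominates the matrix coefficients for any bounded
`Y`, so a bound on the quadratic form at `Y = I` suffices. -/
theorem summable_PhiTerm_of_bound {C : ℝ} (hC : ∀ (s : Finset (FreeMonoid (Fin n))) (h : H),
    ∑ α ∈ s, f.coeff α * ‖adjoint (monomial X α) h‖ ^ 2 ≤ C * ‖h‖ ^ 2) (Y : H →L[ℂ] H) :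
    Summable (f.PhiTerm X Y) := by
  set c : H → FreeMonoid (Fin n) → ℝ := fun h α => √(f.coeff α) * ‖adjoint (monomial X α) h‖
  have hc : ∀ h α, c h α ^ 2 = f.coeff α * ‖adjoint (monomial X α) h‖ ^ 2 := fun h α => by
    rw [mul_pow, Real.sq_sqrt (f.coeff_nonneg α)]
  have hle : ∀ g h α, ‖⟪g, f.PhiTerm X Y α h⟫_ℂ‖ ≤ ‖Y‖ * (c g α * c h α) := by
    intro g h α
    rw [inner_PhiTerm, norm_mul, Complex.norm_real, Real.norm_of_nonneg (f.coeff_nonneg α)]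
    have h1 : ‖⟪adjoint (monomial X α) g, Y (adjoint (monomial X α) h)⟫_ℂ‖ ≤
        ‖adjoint (monomial X α) g‖ * (‖Y‖ * ‖adjoint (monomial X α) h‖) :=
      (norm_inner_le_norm _ _).trans
        (mul_le_mul_of_nonneg_left (Y.le_opNorm _) (norm_nonneg _))
    refine (mul_le_mul_of_nonneg_left h1 (f.coeff_nonneg α)).trans (le_of_eq ?_)
    have := Real.mul_self_sqrt (f.coeff_nonneg α)
    simp only [c]
    linear_combination (-‖adjoint (monomial X α) g‖ * ‖Y‖ * ‖adjoint (monomial X α) h‖) * this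
  -- The sign of `C` is not known, hence `|C|` under the square root.
  have hfin : ∀ (s : Finset (FreeMonoid (Fin n))) g h,
      ∑ α ∈ s, c g α * c h α ≤ |C| * ‖g‖ * ‖h‖ := by
    intro s g h
    refine (Real.sum_mul_le_sqrt_mul_sqrt s (c g) (c h)).trans ?_
    have hb : ∀ h, √(∑ α ∈ s, c h α ^ 2) ≤ √|C| * ‖h‖ := by
      intro h
      rw [Real.sqrt_le_left (by positivity), mul_pow, Real.sq_sqrt (abs_nonneg C)]
      simp only [hc]
      exact (hC s h).trans (mul_le_mul_of_nonneg_right (le_abs_self C) (sq_nonneg _))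
    refine (mul_le_mul (hb g) (hb h) (Real.sqrt_nonneg _) (by positivity)).trans (le_of_eq ?_)
    have := Real.mul_self_sqrt (abs_nonneg C)
    linear_combination (‖g‖ * ‖h‖) * this
  have hsum : ∀ g h, Summable fun α => ⟪g, f.PhiTerm X Y α h⟫_ℂ := by
    intro g h
    refine Summable.of_norm_bounded (g := fun α => ‖Y‖ * (c g α * c h α)) ?_ (hle g h)
    refine Summable.mul_left _ (summable_of_sum_le (fun α => by positivity) (hfin · g h))
  obtain ⟨S, hS⟩ := exists_weak_limit (l := (atTop : Filter (Finset (FreeMonoid (Fin n)))))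
    (fun s => ∑ α ∈ s, (f.PhiTerm X Y α).toCLM) (‖Y‖ * |C|)
    (by
      intro s g h
      rw [sum_apply, inner_sum]
      refine (norm_sum_le _ _).trans ?_
      refine (Finset.sum_le_sum fun α _ => hle g h α).trans ?_
      rw [← Finset.mul_sum]
      exact (mul_le_mul_of_nonneg_left (hfin s g h) (norm_nonneg _)).trans (le_of_eq (by ring)))
    (by
      intro g h
      obtain ⟨z, hz⟩ := hsum g h
      refine ⟨z, ?_⟩
      simp only [sum_apply, inner_sum]
      exact hz)
  refine ⟨.ofCLM S, hasSum_wot_iff.2 fun g h => ?_⟩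
  simp only [sum_apply, inner_sum] at hS
  exact hS g h

/-- The quadratic form at `I` has nonnegative terms, so its partial sums stay below the full sum;
the norm of the weak sum serves as `C`. -/
theorem bound_of_summable (hX : Summable (f.PhiTerm X 1)) :
    ∃ C : ℝ, ∀ (s : Finset (FreeMonoid (Fin n))) (h : H),
      ∑ α ∈ s, f.coeff α * ‖adjoint (monomial X α) h‖ ^ 2 ≤ C * ‖h‖ ^ 2 := by
  obtain ⟨S, hS⟩ := hX
  refine ⟨‖S.toCLM‖, fun s h => ?_⟩
  have h1 := hasSum_wot_iff.1 hS h h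
  have h2 : HasSum (fun α => f.coeff α * ‖adjoint (monomial X α) h‖ ^ 2) (⟪h, S h⟫_ℂ).re := by
    convert Complex.hasSum_re h1 using 2 with α
    rw [inner_PhiTerm, one_apply_eq_self, inner_self_eq_norm_sq_to_K, Complex.re_ofReal_mul]
    norm_cast
  refine (sum_le_hasSum s (fun α _ => mul_nonneg (f.coeff_nonneg α) (sq_nonneg _)) h2).trans ?_
  refine (Complex.re_le_norm _).trans ((norm_inner_le_norm _ _).trans ?_)
  have := mul_le_mul_of_nonneg_left (S.toCLM.le_opNorm h) (norm_nonneg h)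
  exact this.trans (le_of_eq (by ring))

theorem summable_PhiTerm (hX : Summable (f.PhiTerm X 1)) (Y : H →L[ℂ] H) :
    Summable (f.PhiTerm X Y) :=
  let ⟨_, hC⟩ := f.bound_of_summable hX
  f.summable_PhiTerm_of_bound hC Y

theorem hasSum_inner_Phi (hX : Summable (f.PhiTerm X 1)) (Y : H →L[ℂ] H) (g h : H) :
    HasSum (fun α => (f.coeff α : ℂ) *
      ⟪adjoint (monomial X α) g, Y (adjoint (monomial X α) h)⟫_ℂ) ⟪g, f.Phi X Y h⟫_ℂ := by
  have := hasSum_wot_iff.1 (f.summable_PhiTerm hX Y).hasSum g h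
  simp only [inner_PhiTerm] at this
  exact this

theorem hasSum_re_inner_Phi (hX : Summable (f.PhiTerm X 1)) (Y : H →L[ℂ] H) (h : H) :
    HasSum (fun α => f.coeff α *
      (⟪adjoint (monomial X α) h, Y (adjoint (monomial X α) h)⟫_ℂ).re)
      (⟪h, f.Phi X Y h⟫_ℂ).re := by
  convert Complex.hasSum_re (f.hasSum_inner_Phi hX Y h h) using 2 with α
  rw [Complex.re_ofReal_mul]

theorem Phi_sub (hX : Summable (f.PhiTerm X 1)) (Y Z : H →L[ℂ] H) :
    f.Phi X (Y - Z) = f.Phi X Y - f.Phi X Z := by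
  refine eq_of_inner_self_eq fun h => (f.hasSum_inner_Phi hX (Y - Z) h h).unique ?_
  simp only [sub_apply, inner_sub_right, mul_sub]
  exact (f.hasSum_inner_Phi hX Y h h).sub (f.hasSum_inner_Phi hX Z h h)

theorem Phi_zero (X : Fin n → H →L[ℂ] H) : f.Phi X 0 = 0 := by
  have : f.PhiTerm X 0 = fun _ => 0 := by
    ext α
    simp [PhiTerm]
  rw [Phi, this, tsum_zero, ContinuousLinearMapWOT.toCLM_zero]

open scoped ComplexOrder in
theorem Phi_nonneg (hX : Summable (f.PhiTerm X 1)) {Y : H →L[ℂ] H} (hY : 0 ≤ Y) :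
    0 ≤ f.Phi X Y := by
  refine nonneg_iff_inner.2 fun h => (f.hasSum_inner_Phi hX Y h h).nonneg fun α => ?_
  exact mul_nonneg (by exact_mod_cast f.coeff_nonneg α) (nonneg_iff_inner.1 hY _)

theorem Phi_iterate_nonneg (hX : Summable (f.PhiTerm X 1)) {Y : H →L[ℂ] H} (hY : 0 ≤ Y) (k : ℕ) :
    0 ≤ (f.Phi X)^[k] Y := by
  induction k with
  | zero => exact hY
  | succ k ih => rw [Function.iterate_succ_apply']; exact f.Phi_nonneg hX ih

theorem Phi_iterate_sub (hX : Summable (f.PhiTerm X 1)) (Y Z : H →L[ℂ] H) (k : ℕ) :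
    (f.Phi X)^[k] (Y - Z) = (f.Phi X)^[k] Y - (f.Phi X)^[k] Z := by
  induction k with
  | zero => rfl
  | succ k ih => simp only [Function.iterate_succ_apply', ih, f.Phi_sub hX]

theorem Phi_iterate_defect_succ (hX : Summable (f.PhiTerm X 1)) (j k : ℕ) :
    (f.Phi X)^[k] (f.defect X (j + 1)) =
      (f.Phi X)^[k] (f.defect X j) - (f.Phi X)^[k + 1] (f.defect X j) := by
  rw [defect, Function.iterate_succ_apply', ← defect, f.Phi_iterate_sub hX,
    Function.iterate_succ_apply]

/-- The weak limit of a sequence of operators is preserved by `Φ` if the sequence is bounded. -/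
theorem tendsto_inner_Phi (hX : Summable (f.PhiTerm X 1)) {A : ℕ → H →L[ℂ] H} {S : H →L[ℂ] H}
    {C : ℝ} (hC : ∀ k h, ‖⟪h, A k h⟫_ℂ‖ ≤ C * ‖h‖ ^ 2)
    (hA : ∀ h, Tendsto (fun k => ⟪h, A k h⟫_ℂ) atTop (𝓝 ⟪h, S h⟫_ℂ)) (h : H) :
    Tendsto (fun k => ⟪h, f.Phi X (A k) h⟫_ℂ) atTop (𝓝 ⟪h, f.Phi X S h⟫_ℂ) := by
  simp only [← fun Y => (f.hasSum_inner_Phi hX Y h h).tsum_eq]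
  -- Dominated convergence over the words.
  refine tendsto_tsum_of_dominated_convergence
    (bound := fun α => C * (f.coeff α * ‖adjoint (monomial X α) h‖ ^ 2)) ?_
    (fun α => (hA _).const_mul _) (Eventually.of_forall fun k α => ?_)
  · obtain ⟨D, hD⟩ := f.bound_of_summable hX
    exact (summable_of_sum_le (fun α => mul_nonneg (f.coeff_nonneg α) (sq_nonneg _))
      (hD · h)).mul_left _
  · rw [norm_mul, Complex.norm_real, Real.norm_of_nonneg (f.coeff_nonneg α), mul_left_comm]
    exact mul_le_mul_of_nonneg_left (hC _ _) (f.coeff_nonneg α)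

end PosRegular

/-! ### Binomial summation of iterated differences -/

section Differences

theorem tsum_ofReal_telescope {x y : ℕ → ℝ} (hdiff : ∀ k, y k = x k - x (k + 1))
    (hy : ∀ k, 0 ≤ y k) {L : ℝ} (hL : Tendsto x atTop (𝓝 L)) (k : ℕ) :
    ∑' i, ENNReal.ofReal (y (k + i)) = ENNReal.ofReal (x k - L) := by
  have h : HasSum (fun i => y (k + i)) (x k - L) := by
    rw [hasSum_iff_tendsto_nat_of_nonneg fun i => hy _]
    have hs : ∀ N, ∑ i ∈ Finset.range N, y (k + i) = x k - x (N + k) := by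
      intro N
      induction N with
      | zero => simp
      | succ N ih => rw [Finset.sum_range_succ, ih, hdiff, add_comm k N, add_right_comm]; ring
    simp only [hs]
    exact tendsto_const_nhds.sub ((tendsto_add_atTop_iff_nat k).2 hL)
  rw [← h.tsum_eq, ENNReal.ofReal_tsum_of_nonneg (fun i => hy _) h.summable]

/-- Sum along the diagonals `k + i = s` and apply the hockey-stick identity. In `ENNReal` the
rearrangement needs no summability. -/
theorem tsum_tsum_choose_mul_add (p : ℕ) (z : ℕ → ENNReal) :
    ∑' k, ∑' i, ((k + p).choose p : ENNReal) * z (k + i) =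
      ∑' s, ((s + p + 1).choose (p + 1) : ENNReal) * z s := by
  rw [← ENNReal.tsum_prod (f := fun k i => ((k + p).choose p : ENNReal) * z (k + i)),
    ← Finset.HasAntidiagonal.sigmaAntidiagonalEquivProd.tsum_eq, ENNReal.tsum_sigma']
  refine tsum_congr fun s => ?_
  rw [tsum_fintype]
  have h1 : ∀ q : Finset.HasAntidiagonal.antidiagonal s,
      ((((Finset.HasAntidiagonal.sigmaAntidiagonalEquivProd ⟨s, q⟩).1 + p).choose p : ENNReal) *
        z ((Finset.HasAntidiagonal.sigmaAntidiagonalEquivProd ⟨s, q⟩).1 +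
          (Finset.HasAntidiagonal.sigmaAntidiagonalEquivProd ⟨s, q⟩).2)) =
      ((q.1.1 + p).choose p : ENNReal) * z s := by
    rintro ⟨q, hq⟩
    rw [Finset.HasAntidiagonal.mem_antidiagonal] at hq
    simp only [Finset.HasAntidiagonal.sigmaAntidiagonalEquivProd_apply, hq]
  rw [Finset.sum_congr rfl fun q _ => h1 q, ← Finset.sum_mul,
    Finset.sum_coe_sort (Finset.HasAntidiagonal.antidiagonal s) (fun q => ((q.1 + p).choose p : ENNReal)),
    Finset.Nat.sum_antidiagonal_eq_sum_range_succ_mk]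
  rw [← Nat.sum_range_add_choose]
  push_cast
  rfl

/-- If all the iterated differences of a convergent sequence up to the order `p + 1` are
nonnegative, then the binomially weighted sum of those of order `p + 1` is the total decrease of the
sequence. -/
theorem tsum_choose_mul_diff (p : ℕ) (x : ℕ → ℕ → ℝ)
    (hdiff : ∀ j k, x (j + 1) k = x j k - x j (k + 1))
    (hpos : ∀ j ≤ p + 1, ∀ k, 0 ≤ x j k) {L : ℝ} (hL : Tendsto (x 0) atTop (𝓝 L)) :
    ∑' k, ((k + p).choose p : ENNReal) * ENNReal.ofReal (x (p + 1) k) =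
      ENNReal.ofReal (x 0 0 - L) := by
  induction p with
  | zero =>
    simpa using tsum_ofReal_telescope (hdiff 0) (hpos 1 le_rfl) hL 0
  | succ p ih =>
    -- Differences of a convergent sequence tend to `0`, so from order one on the telescoping sums
    -- have no limit term.
    have hlim : ∀ j, Tendsto (x (j + 1)) atTop (𝓝 0) := by
      intro j
      induction j with
      | zero =>
        simpa [funext (hdiff 0)] using hL.sub ((tendsto_add_atTop_iff_nat 1).2 hL)
      | succ j ihj =>
        simpa [funext (hdiff (j + 1))] using ihj.sub ((tendsto_add_atTop_iff_nat 1).2 ihj)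
    rw [← ih fun j hj => hpos j (by omega)]
    have h1 : ∀ k, ENNReal.ofReal (x (p + 1) k) = ∑' i, ENNReal.ofReal (x (p + 2) (k + i)) :=
      fun k => by
        rw [tsum_ofReal_telescope (hdiff (p + 1)) (hpos (p + 2) le_rfl) (hlim p) k, sub_zero]
    simp only [h1, ← ENNReal.tsum_mul_left]
    rw [tsum_tsum_choose_mul_add p fun s => ENNReal.ofReal (x (p + 2) s)]
    rfl

end Differences

/-! ### Expansion over words and the weights `b_α` -/

namespace PosRegular

variable {n : ℕ} (f : PosRegular n) {H : Type*} [NormedAddCommGroup H] [InnerProductSpace ℂ H]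
  [CompleteSpace H] {X : Fin n → H →L[ℂ] H}

open ContinuousLinearMap (adjoint)

/-- The product of the coefficients of a list of words. -/
def listCoeff (L : List (FreeMonoid (Fin n))) : ℝ := (L.map f.coeff).prod

theorem listCoeff_nonneg (L : List (FreeMonoid (Fin n))) : 0 ≤ f.listCoeff L := by
  refine List.prod_nonneg fun x hx => ?_
  obtain ⟨γ, -, rfl⟩ := List.mem_map.1 hx
  exact f.coeff_nonneg _

/-- The quadratic form of `X_α Y X_α^*`. -/
def wordForm (X : Fin n → H →L[ℂ] H) (Y : H →L[ℂ] H) (h : H) (α : FreeMonoid (Fin n)) : ℝ :=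
  (⟪adjoint (monomial X α) h, Y (adjoint (monomial X α) h)⟫_ℂ).re

theorem wordForm_nonneg (X : Fin n → H →L[ℂ] H) {Y : H →L[ℂ] H} (hY : 0 ≤ Y) (h : H)
    (α : FreeMonoid (Fin n)) : 0 ≤ wordForm X Y h α := re_inner_nonneg hY _

theorem wordForm_mul (X : Fin n → H →L[ℂ] H) (Y : H →L[ℂ] H) (h : H) (α β : FreeMonoid (Fin n)) :
    wordForm X Y h (α * β) = wordForm X Y (adjoint (monomial X α) h) β := by
  have : adjoint (monomial X (α * β)) h = adjoint (monomial X β) (adjoint (monomial X α) h) := by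
    rw [monomial_mul, ← ContinuousLinearMap.star_eq_adjoint, star_mul]
    rfl
  rw [wordForm, wordForm, this]

/-- Induction on `k`: the outermost Φ contributes the first word of the tuple, since `X_{αβ}^* =
X_β^* X_α^*`. -/
theorem ofReal_inner_Phi_iterate (hX : Summable (f.PhiTerm X 1)) {Y : H →L[ℂ] H} (hY : 0 ≤ Y)
    (k : ℕ) (h : H) :
    ENNReal.ofReal (⟪h, (f.Phi X)^[k] Y h⟫_ℂ).re =
      ∑' v : Fin k → FreeMonoid (Fin n), ENNReal.ofReal
        (f.listCoeff (List.ofFn v) * wordForm X Y h (List.ofFn v).prod) := by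
  induction k generalizing h with
  | zero => simp [listCoeff, wordForm, ← ContinuousLinearMap.star_eq_adjoint]
  | succ k ih =>
    have h1 := f.hasSum_re_inner_Phi hX ((f.Phi X)^[k] Y) h
    have h2 := f.Phi_iterate_nonneg hX hY k
    rw [Function.iterate_succ_apply', ← h1.tsum_eq, ENNReal.ofReal_tsum_of_nonneg
      (fun α => mul_nonneg (f.coeff_nonneg α) (re_inner_nonneg h2 _)) h1.summable,
      ← (Fin.consEquiv fun _ => FreeMonoid (Fin n)).tsum_eq, ENNReal.tsum_prod']
    refine tsum_congr fun α => ?_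
    rw [ENNReal.ofReal_mul (f.coeff_nonneg α), ih, ← ENNReal.tsum_mul_left]
    refine tsum_congr fun v => ?_
    rw [← ENNReal.ofReal_mul (f.coeff_nonneg α)]
    congr 1
    have hv : List.ofFn (Fin.consEquiv (fun _ => FreeMonoid (Fin n)) (α, v)) =
      α :: List.ofFn v := List.ofFn_cons α v
    rw [hv]
    simp only [List.prod_cons, wordForm_mul, listCoeff, List.map_cons, mul_assoc]

/-- Compositions of `|α|` are the factorizations of `α` into nonempty words. Lists with an empty
word add nothing because `a_{g₀} = 0`, so the sum may run over all lists with product `α`. -/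
theorem tsum_listCoeff_fiber (m : ℕ) (α : FreeMonoid (Fin n)) :
    ∑' L : {L : List (FreeMonoid (Fin n)) // L.prod = α},
      ENNReal.ofReal (f.listCoeff L.1 * ((L.1.length + m - 1).choose (m - 1) : ℝ)) =
      ENNReal.ofReal (f.b m α) := by
  let ι : Composition α.toList.length → {L : List (FreeMonoid (Fin n)) // L.prod = α} := fun c =>
    ⟨(α.toList.splitWrtComposition c).map FreeMonoid.ofList, by
      apply FreeMonoid.toList.injective
      rw [FreeMonoid.toList_prod, List.map_map]
      simp⟩
  have hι : Function.Injective ι := by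
    intro c d hcd
    have h1 : α.toList.splitWrtComposition c = α.toList.splitWrtComposition d :=
      List.map_injective_iff.2 FreeMonoid.ofList.injective (congrArg Subtype.val hcd)
    have h2 := congrArg (List.map List.length) h1
    rw [List.map_length_splitWrtComposition, List.map_length_splitWrtComposition] at h2
    exact Composition.ext h2
  rw [← hι.tsum_eq, tsum_fintype, b, ENNReal.ofReal_sum_of_nonneg
    fun c _ => f.bTerm_nonneg m _ c]
  · refine Finset.sum_congr rfl fun c _ => ?_
    simp [ι, bTerm, listCoeff, List.map_map, Function.comp_def]
  · rintro ⟨L, rfl⟩ hL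
    have h0 : ∀ γ ∈ L, γ ≠ 1 := by
      rintro γ hγ rfl
      refine hL ?_
      have : f.listCoeff L = 0 :=
        List.prod_eq_zero (List.mem_map.2 ⟨1, hγ, f.coeff_one⟩)
      simp [this]
    -- The word lengths in the list recover the composition.
    let c : Composition L.prod.toList.length :=
      ⟨(L.map FreeMonoid.toList).map List.length, by
        intro i hi
        simp only [List.map_map, List.mem_map] at hi
        obtain ⟨γ, hγ, rfl⟩ := hi
        exact List.length_pos_iff.2 fun h => h0 γ hγ (FreeMonoid.toList.injective h), by
        rw [FreeMonoid.toList_prod, List.length_flatten]⟩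
    refine ⟨c, Subtype.ext ?_⟩
    have h3 : L.prod.toList.splitWrtComposition c = L.map FreeMonoid.toList := by
      rw [List.eq_iff_flatten_eq, List.flatten_splitWrtComposition,
        List.map_length_splitWrtComposition]
      exact ⟨FreeMonoid.toList_prod L, rfl⟩
    change (L.prod.toList.splitWrtComposition c).map FreeMonoid.ofList = L
    rw [h3]
    simp

theorem tsum_b_mul_wordForm (hX : Summable (f.PhiTerm X 1)) (p : ℕ)
    (hpos : ∀ k, 1 ≤ k → k ≤ p + 1 → 0 ≤ f.defect X k) (h : H) {l : ℝ}
    (hl : Tendsto (fun k => (⟪h, (f.Phi X)^[k] 1 h⟫_ℂ).re) atTop (𝓝 l)) :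
    ∑' α, ENNReal.ofReal (f.b (p + 1) α * wordForm X (f.defect X (p + 1)) h α) =
      ENNReal.ofReal (‖h‖ ^ 2 - l) := by
  have hpos' : ∀ j ≤ p + 1, 0 ≤ f.defect X j := by
    intro j hj
    rcases Nat.eq_zero_or_pos j with rfl | hj0
    · exact zero_le_one
    · exact hpos j hj0 hj
  have hY := hpos' (p + 1) le_rfl
  -- The `j`-th differences of `k ↦ ⟪h, Φ^k(I) h⟫` are the forms of `Φ^k((id - Φ)^j I)`. Here `m = p
  -- + 1`, so `m - 1 = p`.
  have key := tsum_choose_mul_diff p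
    (fun j k => (⟪h, (f.Phi X)^[k] (f.defect X j) h⟫_ℂ).re)
    (fun j k => by simp [f.Phi_iterate_defect_succ hX])
    (fun j hj k => re_inner_nonneg (f.Phi_iterate_nonneg hX (hpos' j hj) k) h) hl
  have h0 : (⟪h, (f.Phi X)^[0] (f.defect X 0) h⟫_ℂ).re = ‖h‖ ^ 2 := by
    simp [defect, ← Complex.ofReal_pow]
  rw [h0] at key
  rw [← key]
  set φ : List (FreeMonoid (Fin n)) → ENNReal := fun L =>
    ENNReal.ofReal (f.listCoeff L * ((L.length + p).choose p : ℝ)) *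
      ENNReal.ofReal (wordForm X (f.defect X (p + 1)) h L.prod) with hφ
  have hk : ∀ k, ((k + p).choose p : ENNReal) *
      ENNReal.ofReal (⟪h, (f.Phi X)^[k] (f.defect X (p + 1)) h⟫_ℂ).re =
      ∑' v : Fin k → FreeMonoid (Fin n), φ (List.ofFn v) := by
    intro k
    rw [f.ofReal_inner_Phi_iterate hX hY, ← ENNReal.tsum_mul_left]
    refine tsum_congr fun v => ?_
    rw [hφ]
    simp only [List.length_ofFn]
    rw [ENNReal.ofReal_mul (f.listCoeff_nonneg _), ENNReal.ofReal_mul (f.listCoeff_nonneg _),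
      ENNReal.ofReal_natCast]
    ring
  simp only [hk]
  -- Tuples of all lengths are gathered into lists, then lists are grouped by their product.
  rw [← ENNReal.tsum_sigma (fun k (v : Fin k → FreeMonoid (Fin n)) => φ (List.ofFn v)),
    show (∑' q : (Σ k, Fin k → FreeMonoid (Fin n)), φ (List.ofFn q.2)) = ∑' L, φ L from
      List.equivSigmaTuple.symm.tsum_eq φ,
    ← (Equiv.sigmaFiberEquiv (List.prod : List (FreeMonoid (Fin n)) → _)).tsum_eq,
    ENNReal.tsum_sigma']
  refine tsum_congr fun α => ?_
  rw [ENNReal.ofReal_mul (f.b_pos _ α).le, ← f.tsum_listCoeff_fiber (p + 1) α,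
    ← ENNReal.tsum_mul_right]
  refine tsum_congr fun L => ?_
  obtain ⟨L, rfl⟩ := L
  rfl

/-- The return from `ENNReal` to `ℝ`; `l ≤ ‖h‖²` is needed because `ENNReal.ofReal` truncates
negative numbers to `0`. -/
theorem hasSum_b_mul_wordForm (hX : Summable (f.PhiTerm X 1)) (p : ℕ)
    (hpos : ∀ k, 1 ≤ k → k ≤ p + 1 → 0 ≤ f.defect X k) (h : H) {l : ℝ}
    (hl : Tendsto (fun k => (⟪h, (f.Phi X)^[k] 1 h⟫_ℂ).re) atTop (𝓝 l)) (hlh : l ≤ ‖h‖ ^ 2) :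
    HasSum (fun α => f.b (p + 1) α * wordForm X (f.defect X (p + 1)) h α) (‖h‖ ^ 2 - l) := by
  have h1 := f.tsum_b_mul_wordForm hX p hpos h hl
  have h0 : ∀ α, 0 ≤ f.b (p + 1) α * wordForm X (f.defect X (p + 1)) h α := fun α =>
    mul_nonneg (f.b_pos _ α).le (wordForm_nonneg X (hpos _ (by omega) le_rfl) h α)
  have hs : Summable fun α => f.b (p + 1) α * wordForm X (f.defect X (p + 1)) h α := by
    have := ENNReal.summable_toReal (h1.trans_ne ENNReal.ofReal_ne_top)
    simpa only [ENNReal.toReal_ofReal (h0 _)] using this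
  rw [← ENNReal.ofReal_tsum_of_nonneg h0 hs,
    ENNReal.ofReal_eq_ofReal_iff (tsum_nonneg h0) (sub_nonneg.2 hlh)] at h1
  exact h1 ▸ hs.hasSum

end PosRegular

open ContinuousLinearMap (adjoint)

/-! ### Positive square roots -/

section SquareRoot

variable {H : Type*} [NormedAddCommGroup H] [InnerProductSpace ℂ H] [CompleteSpace H]

theorem inner_sqrt_apply {A : H →L[ℂ] H} (hA : 0 ≤ A) (g h : H) :
    ⟪CFC.sqrt A g, CFC.sqrt A h⟫_ℂ = ⟪g, A h⟫_ℂ := by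
  have hs : adjoint (CFC.sqrt A) = CFC.sqrt A :=
    (IsSelfAdjoint.of_nonneg (CFC.sqrt_nonneg A)).star_eq
  conv_rhs => rw [← CFC.sqrt_mul_sqrt_self A hA, mul_apply_eq_comp,
    ← ContinuousLinearMap.adjoint_inner_left, hs]

theorem norm_sqrt_apply_sq {A : H →L[ℂ] H} (hA : 0 ≤ A) (h : H) :
    ‖CFC.sqrt A h‖ ^ 2 = (⟪h, A h⟫_ℂ).re := by
  rw [← inner_sqrt_apply hA, inner_self_eq_norm_sq_to_K]
  norm_cast

end SquareRoot

/-! ### The Hilbert space tensor product -/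

section HilbertTensor

variable {E E' F : Type*} [NormedAddCommGroup E] [InnerProductSpace ℂ E]
  [NormedAddCommGroup E'] [InnerProductSpace ℂ E'] [NormedAddCommGroup F] [InnerProductSpace ℂ F]

/-- The map `e ↦ e ⊗ d` into the Hilbert space tensor product. -/
def tmulL (E : Type*) [NormedAddCommGroup E] [InnerProductSpace ℂ E] (d : F) :
    E →L[ℂ] HilbertTensor E F :=
  UniformSpace.Completion.toComplL ∘L (TensorProduct.mkL ℂ E F).flip d

theorem tmulL_apply (d : F) (e : E) :
    tmulL E d e = ((e ⊗ₜ[ℂ] d : E ⊗[ℂ] F) : HilbertTensor E F) := rfl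

theorem inner_tmulL (d d' : F) (e e' : E) :
    ⟪tmulL E d e, tmulL E d' e'⟫_ℂ = ⟪e, e'⟫_ℂ * ⟪d, d'⟫_ℂ := by
  rw [tmulL_apply, tmulL_apply, UniformSpace.Completion.inner_coe, TensorProduct.inner_tmul]

theorem hilbertTensor_ext {x y : HilbertTensor E F}
    (h : ∀ e d, ⟪x, tmulL E d e⟫_ℂ = ⟪y, tmulL E d e⟫_ℂ) : x = y := by
  refine ext_inner_right ℂ fun z => ?_
  induction z using UniformSpace.Completion.induction_on with
  | hp => exact isClosed_eq (by fun_prop) (by fun_prop)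
  | ih z =>
    induction z using TensorProduct.induction_on with
    | zero => rw [UniformSpace.Completion.coe_zero, inner_zero_right, inner_zero_right]
    | tmul e d => exact h e d
    | add a b ha hb => rw [UniformSpace.Completion.coe_add, inner_add_right, inner_add_right, ha, hb]

theorem completion_rTensor_tmulL (A : E →L[ℂ] E') (d : F) (e : E) :
    (A.rTensor F).completion (tmulL E d e) = tmulL E' d (A e) := by
  rw [tmulL_apply, ContinuousLinearMap.completion_apply_coe]
  rfl

theorem adjoint_completion_rTensor [CompleteSpace E] [CompleteSpace E'] (A : E →L[ℂ] E') :
    adjoint (A.rTensor F).completion = ((adjoint A).rTensor F).completion := by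
  symm
  rw [ContinuousLinearMap.eq_adjoint_iff]
  intro x y
  induction x, y using UniformSpace.Completion.induction_on₂ with
  | hp => exact isClosed_eq (by fun_prop) (by fun_prop)
  | ih x y =>
    simp only [ContinuousLinearMap.completion_apply_coe, UniformSpace.Completion.inner_coe]
    induction x using TensorProduct.induction_on with
    | zero => simp
    | add a b ha hb => rw [map_add, inner_add_left, inner_add_left, ha, hb]
    | tmul e d =>
      induction y using TensorProduct.induction_on with
      | zero => simp
      | add a b ha hb => rw [map_add, inner_add_right, inner_add_right, ha, hb]
      | tmul e' d' =>
        simp only [ContinuousLinearMap.rTensor_tmul, TensorProduct.inner_tmul,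
          ContinuousLinearMap.adjoint_inner_left]

/-- A square-summable family of operators `H → D`, as an operator `H → ℓ² ⊗ D`. -/
theorem exists_column {ι H : Type*} [DecidableEq ι] [NormedAddCommGroup H] [InnerProductSpace ℂ H]
    (R : ι → H →L[ℂ] F) (c : H → ℝ) (hR : ∀ h, HasSum (fun i => ‖R i h‖ ^ 2) (c h))
    (hc : ∀ h, c h ≤ ‖h‖ ^ 2) :
    ∃ K : H →L[ℂ] HilbertTensor (lp (fun _ : ι => ℂ) 2) F, (∀ h, ‖K h‖ ^ 2 = c h) ∧
      ∀ h i d, ⟪K h, tmulL _ d (lp.single 2 i 1)⟫_ℂ = ⟪R i h, d⟫_ℂ := by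
  -- The embeddings `d ↦ e_i ⊗ d` are isometries with orthogonal ranges, so together they embed
  -- `ℓ²(ι; F)` isometrically; `K` is the column into `ℓ²(ι; F)` followed by this embedding.
  let V : ι → F →ₗᵢ[ℂ] HilbertTensor (lp (fun _ : ι => ℂ) 2) F := fun i =>
    { toFun := fun d => tmulL _ d (lp.single 2 i 1)
      map_add' := fun d d' => by simp [tmulL]
      map_smul' := fun z d => by simp [tmulL]
      norm_map' := fun d => by
        change ‖tmulL _ d (lp.single 2 i 1)‖ = ‖d‖
        rw [tmulL_apply, UniformSpace.Completion.norm_coe, TensorProduct.norm_tmul,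
          lp.norm_single (by norm_num), norm_one, one_mul] }
  have hVapp : ∀ i d, V i d = tmulL _ d (lp.single 2 i 1) := fun _ _ => rfl
  have hV : OrthogonalFamily ℂ (fun _ : ι => F) V := by
    intro i j hij d d'
    rw [hVapp, hVapp, inner_tmulL, lp.inner_single_left, lp.single_apply, Pi.single_apply,
      if_neg hij, inner_zero_right, zero_mul]
  have hmem : ∀ h, Memℓp (fun i => R i h) 2 := fun h =>
    memℓp_gen (by simpa using (hR h).summable)
  let K₀ : H →ₗ[ℂ] lp (fun _ : ι => F) 2 :=
    { toFun := fun h => ⟨fun i => R i h, hmem h⟩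
      map_add' := fun h h' => by ext i; exact map_add (R i) h h'
      map_smul' := fun z h => by ext i; exact map_smul (R i) z h }
  have hK₀ : ∀ h, ‖K₀ h‖ ^ 2 = c h := by
    intro h
    have := lp.hasSum_norm (p := 2) (by norm_num) (K₀ h)
    simp only [ENNReal.toReal_ofNat, Real.rpow_ofNat] at this
    exact this.unique (hR h)
  let K₁ : H →L[ℂ] lp (fun _ : ι => F) 2 := K₀.mkContinuous 1 fun h => by
    rw [one_mul]
    exact le_of_sq_le_sq ((hK₀ h).trans_le (hc h)) (norm_nonneg _)
  refine ⟨hV.linearIsometry.toContinuousLinearMap ∘L K₁, fun h => ?_, fun h i d => ?_⟩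
  · change ‖hV.linearIsometry (K₀ h)‖ ^ 2 = c h
    rw [LinearIsometry.norm_map, hK₀]
  · rw [← hVapp, ← hV.linearIsometry_apply_single]
    change ⟪hV.linearIsometry (K₀ h), hV.linearIsometry (lp.single 2 i d)⟫_ℂ = _
    rw [LinearIsometry.inner_map_map, lp.inner_single_right]
    rfl

/-- If `K` takes its values in the range of `P^* P ⊗ I`, then it factors through `P ⊗ I`. -/
theorem exists_compression {H : Type*} [NormedAddCommGroup H] [InnerProductSpace ℂ H]
    [CompleteSpace E] [CompleteSpace E'] (P : E →L[ℂ] E') (K : H →L[ℂ] HilbertTensor E F)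
    (hP : ∀ h d v, ⟪K h, tmulL E d (adjoint P (P v))⟫_ℂ = ⟪K h, tmulL E d v⟫_ℂ) :
    ∃ J : H →L[ℂ] HilbertTensor E' F, (∀ h, ‖J h‖ = ‖K h‖) ∧
      ∀ h d v, ⟪J h, tmulL E' d v⟫_ℂ = ⟪K h, tmulL E d (adjoint P v)⟫_ℂ := by
  have hJ : ∀ h d v, ⟪(P.rTensor F).completion (K h), tmulL E' d v⟫_ℂ =
      ⟪K h, tmulL E d (adjoint P v)⟫_ℂ := by
    intro h d v
    rw [← ContinuousLinearMap.adjoint_inner_right, adjoint_completion_rTensor,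
      completion_rTensor_tmulL]
  refine ⟨(P.rTensor F).completion ∘L K, fun h => ?_, hJ⟩
  -- `(P ⊗ I)^* (P ⊗ I)` fixes `K h`, as tested on elementary tensors; pairing with `K h` gives
  -- equality of norms.
  have h1 : adjoint (P.rTensor F).completion ((P.rTensor F).completion (K h)) = K h := by
    refine hilbertTensor_ext fun v d => ?_
    rw [ContinuousLinearMap.adjoint_inner_left, completion_rTensor_tmulL, hJ, hP]
  have h2 := congrArg (fun z => ⟪z, K h⟫_ℂ) h1
  simp only [ContinuousLinearMap.adjoint_inner_left, inner_self_eq_norm_sq_to_K] at h2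
  rw [ContinuousLinearMap.comp_apply]
  refine (sq_eq_sq₀ (norm_nonneg _) (norm_nonneg _)).1 ?_
  exact_mod_cast h2

end HilbertTensor

/-! ### Poisson kernels -/

namespace PosRegular

variable {n : ℕ} (f : PosRegular n) {H : Type*} [NormedAddCommGroup H] [InnerProductSpace ℂ H]
  [CompleteSpace H] {T : Fin n → H →L[ℂ] H}

theorem W_single (m : ℕ) (i : Fin n) (γ : FreeMonoid (Fin n)) :
    f.W m i (lp.single 2 γ 1) = (f.weight m i γ : ℂ) • lp.single 2 (FreeMonoid.of i * γ) 1 := by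
  ext α
  change f.shiftFun m i (lp.single 2 γ 1 : Fock n) α = _
  rw [lp.coeFn_smul, Pi.smul_apply, lp.single_apply, Pi.single_apply]
  by_cases h : ∃ β, FreeMonoid.of i * β = α
  · obtain ⟨β, rfl⟩ := h
    rw [shiftFun, (mul_right_injective (FreeMonoid.of i)).extend_apply, lp.single_apply,
      Pi.single_apply]
    by_cases hβ : β = γ <;> simp [hβ]
  · rw [shiftFun, Function.extend_apply' _ _ _ h, if_neg fun h' => h ⟨γ, h'.symm⟩]
    simp

/-- The weights of `W_i` are chosen for this cancellation: it makes the Poisson kernel, with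
coefficients `√b_α`, an intertwiner. -/
theorem sqrt_b_mul_weight (m : ℕ) (i : Fin n) (γ : FreeMonoid (Fin n)) :
    √(f.b m (FreeMonoid.of i * γ)) * f.weight m i γ = √(f.b m γ) := by
  have h := Real.sqrt_ne_zero'.2 (f.b_pos m (FreeMonoid.of i * γ))
  rw [weight, Real.sqrt_div (f.b_pos m γ).le, mul_div_cancel₀ _ h]

/-- `Δ_{f,m,T}` as an operator from `H` to the closure of its range. -/
def DeltaL (m : ℕ) (T : Fin n → H →L[ℂ] H) : H →L[ℂ] f.defectSpace m T :=
  (f.Delta m T).codRestrict _ fun h => Submodule.le_topologicalClosure _ ⟨h, rfl⟩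

theorem norm_DeltaL_sq {m : ℕ} (hT : 0 ≤ f.defect T m) (h : H) :
    ‖f.DeltaL m T h‖ ^ 2 = (⟪h, f.defect T m h⟫_ℂ).re :=
  norm_sqrt_apply_sq hT h

theorem adjoint_monomial_of_mul (T : Fin n → H →L[ℂ] H) (i : Fin n) (γ : FreeMonoid (Fin n))
    (h : H) : adjoint (monomial T (FreeMonoid.of i * γ)) h =
      adjoint (monomial T γ) (adjoint (T i) h) := by
  rw [monomial_mul, monomial_of, ← ContinuousLinearMap.star_eq_adjoint, star_mul]
  rfl

/-- The noncommutative Poisson kernel of `T`, with values in `F²(Hₙ) ⊗ D`. -/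
theorem exists_poissonKernel {m : ℕ} (hT : 0 ≤ f.defect T m) {c : H → ℝ}
    (hsum : ∀ h, HasSum (fun α => f.b m α * wordForm T (f.defect T m) h α) (c h))
    (hc : ∀ h, c h ≤ ‖h‖ ^ 2) :
    ∃ K : H →L[ℂ] HilbertTensor (Fock n) (f.defectSpace m T), (∀ h, ‖K h‖ ^ 2 = c h) ∧
      ∀ i h d v, ⟪K h, tmulL _ d (f.W m i v)⟫_ℂ = ⟪K (adjoint (T i) h), tmulL _ d v⟫_ℂ := by
  obtain ⟨K, hK, hK'⟩ := exists_column
    (fun α => ((√(f.b m α) : ℝ) : ℂ) • (f.DeltaL m T ∘L adjoint (monomial T α))) c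
    (by
      intro h
      convert hsum h using 2 with α
      rw [smul_apply, norm_smul, mul_pow, Complex.norm_real, Real.norm_eq_abs,
        sq_abs, Real.sq_sqrt (f.b_pos m α).le, ContinuousLinearMap.comp_apply,
        f.norm_DeltaL_sq hT]
      rfl) hc
  refine ⟨K, hK, fun i h d v => ?_⟩
  -- Both sides are continuous functionals of `v`, so the basis vectors `e_γ` suffice; there `T_{g_i
  -- γ}^* = T_γ^* T_i^*` applies.
  have key : innerSL ℂ (K h) ∘L tmulL _ d ∘L f.W m i =
      innerSL ℂ (K (adjoint (T i) h)) ∘L tmulL _ d := by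
    refine lp.ext_continuousLinearMap (by norm_num) fun γ => ?_
    ext
    change ⟪K h, tmulL _ d (f.W m i (lp.single 2 γ 1))⟫_ℂ =
      ⟪K (adjoint (T i) h), tmulL _ d (lp.single 2 γ 1)⟫_ℂ
    rw [f.W_single, map_smul, inner_smul_right, hK', hK']
    simp only [smul_apply, ContinuousLinearMap.comp_apply, inner_smul_left,
      adjoint_monomial_of_mul, Complex.conj_ofReal, ← f.sqrt_b_mul_weight m i γ, Complex.ofReal_mul,
      map_mul]
    ring
  exact DFunLike.congr_fun key v

/-- The constrained Poisson kernel, with values in `N_Q ⊗ D`. -/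
theorem exists_constrained_poissonKernel {m : ℕ} (hT : 0 ≤ f.defect T m) {c : H → ℝ}
    (hsum : ∀ h, HasSum (fun α => f.b m α * wordForm T (f.defect T m) h α) (c h))
    (hc : ∀ h, c h ≤ ‖h‖ ^ 2) {Q : Set (FreeAlgebra ℂ (Fin n))} (hQ : ∀ q ∈ Q, polyEval T q = 0) :
    ∃ K : H →L[ℂ] HilbertTensor (f.NQ m Q) (f.defectSpace m T), (∀ h, ‖K h‖ ^ 2 = c h) ∧
      ∀ i h, adjoint (ampliation (f.defectSpace m T) (f.B m Q i)) (K h) =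
        K (adjoint (T i) h) := by
  obtain ⟨K, hK, hKW⟩ := f.exists_poissonKernel hT hsum hc
  have hG : ∀ d i v, (adjoint K ∘L tmulL _ d) (f.W m i v) = T i ((adjoint K ∘L tmulL _ d) v) := by
    intro d i v
    refine ext_inner_left ℂ fun h => ?_
    rw [← ContinuousLinearMap.adjoint_inner_left (T i)]
    simp only [ContinuousLinearMap.comp_apply, ContinuousLinearMap.adjoint_inner_right]
    exact hKW i h d v
  -- The map `K^*(· ⊗ d)` sends `W_α q(W) W_β 1` to `T_α q(T) T_β` applied to a vector, which is
  -- `0`; by continuity it kills `M_Q`.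
  have hM : ∀ d, ∀ v ∈ f.MQ m Q, (adjoint K ∘L tmulL _ d) v = 0 := by
    intro d
    refine Submodule.topologicalClosure_minimal _ (t := LinearMap.ker
      (adjoint K ∘L tmulL _ d).toLinearMap) (Submodule.span_le.2 ?_)
      (ContinuousLinearMap.isClosed_ker _)
    rintro _ ⟨q, hq, α, β, rfl⟩
    change (adjoint K ∘L tmulL _ d) _ = 0
    rw [intertwine_monomial _ (hG d), intertwine_polyEval _ (hG d), hQ q hq]
    simp
  have hP : ∀ h d (v : Fock n), ⟪K h, tmulL _ d ((f.NQ m Q).starProjection v)⟫_ℂ =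
      ⟪K h, tmulL _ d v⟫_ℂ := by
    intro h d v
    -- `M_Q` is closed, hence `M_Qᗮᗮ = M_Q`.
    have h1 : v - (f.NQ m Q).starProjection v ∈ f.MQ m Q := by
      have h2 := (f.NQ m Q).sub_starProjection_mem_orthogonal v
      rwa [show (f.NQ m Q)ᗮ = (f.MQ m Q)ᗮᗮ from rfl,
        Submodule.orthogonal_orthogonal_eq_closure, IsClosed.submodule_topologicalClosure_eq
        (s := f.MQ m Q) (Submodule.isClosed_topologicalClosure _)] at h2
    have h2 := congrArg (fun z => ⟪h, z⟫_ℂ) (hM d _ h1)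
    simp only [ContinuousLinearMap.comp_apply, ContinuousLinearMap.adjoint_inner_right, map_sub,
      inner_sub_right, inner_zero_right] at h2
    exact (sub_eq_zero.1 h2).symm
  obtain ⟨J, hJ, hJt⟩ := exists_compression (f.NQ m Q).orthogonalProjectionOnto K (by
    rw [Submodule.adjoint_orthogonalProjectionOnto]
    exact hP)
  rw [Submodule.adjoint_orthogonalProjectionOnto] at hJt
  refine ⟨J, fun h => by rw [hJ, hK], fun i h => hilbertTensor_ext fun v d => ?_⟩
  rw [ContinuousLinearMap.adjoint_inner_left, ampliation, completion_rTensor_tmulL, hJt, hJt]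
  refine Eq.trans ?_ (hKW i h d v)
  exact hP h d _

end PosRegular

/-! ### Direct sums and factorization of positive operators -/

theorem adjoint_directSum {E K : Type*} [NormedAddCommGroup E] [InnerProductSpace ℂ E]
    [NormedAddCommGroup K] [InnerProductSpace ℂ K] [CompleteSpace E] [CompleteSpace K]
    (A : E →L[ℂ] E) (U : K →L[ℂ] K) :
    adjoint (directSum A U) = directSum (adjoint A) (adjoint U) := by
  symm
  rw [ContinuousLinearMap.eq_adjoint_iff]
  intro x y
  rw [WithLp.prod_inner_apply, WithLp.prod_inner_apply]
  change ⟪adjoint A x.fst, y.fst⟫_ℂ + ⟪adjoint U x.snd, y.snd⟫_ℂ =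
    ⟪x.fst, A y.fst⟫_ℂ + ⟪x.snd, U y.snd⟫_ℂ
  rw [ContinuousLinearMap.adjoint_inner_left, ContinuousLinearMap.adjoint_inner_left]

/-- Two operators that intertwine `T_i^*` with `A_i^*` and `U_i^*`, and whose column is isometric,
give an isometry that intertwines `T_i^*` with `(A_i ⊕ U_i)^*`. -/
theorem exists_isometry_directSum {ι H E K : Type*} [NormedAddCommGroup H] [InnerProductSpace ℂ H]
    [CompleteSpace H] [NormedAddCommGroup E] [InnerProductSpace ℂ E] [NormedAddCommGroup K]
    [InnerProductSpace ℂ K] [CompleteSpace E] [CompleteSpace K] (T : ι → H →L[ℂ] H)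
    (A : ι → E →L[ℂ] E) (U : ι → K →L[ℂ] K) (J₁ : H →L[ℂ] E) (Y : H →L[ℂ] K)
    (hJ₁ : ∀ i h, adjoint (A i) (J₁ h) = J₁ (adjoint (T i) h))
    (hY : ∀ i h, adjoint (U i) (Y h) = Y (adjoint (T i) h))
    (hnorm : ∀ h, ‖J₁ h‖ ^ 2 + ‖Y h‖ ^ 2 = ‖h‖ ^ 2) :
    ∃ J : H →ₗᵢ[ℂ] WithLp 2 (E × K),
      ∀ i h, adjoint (directSum (A i) (U i)) (J h) = J (adjoint (T i) h) := by
  refine ⟨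
    { toFun := fun h => WithLp.toLp 2 (J₁ h, Y h)
      map_add' := fun g h => by simp [← WithLp.toLp_add]
      map_smul' := fun c h => by simp [← WithLp.toLp_smul]
      norm_map' := fun h => by
        refine (sq_eq_sq₀ (norm_nonneg _) (norm_nonneg _)).1 ?_
        rw [WithLp.prod_norm_sq_eq_of_L2]
        exact hnorm h }, fun i h => ?_⟩
  rw [adjoint_directSum]
  change WithLp.toLp 2 (adjoint (A i) (J₁ h), adjoint (U i) (Y h)) =
    WithLp.toLp 2 (J₁ (adjoint (T i) h), Y (adjoint (T i) h))
  rw [hJ₁, hY]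

/-- A positive operator `S` factors as `Y^* Y` through a Hilbert space in which `Y` has dense
range. -/
theorem exists_dense_factorization {H : Type u} [NormedAddCommGroup H] [InnerProductSpace ℂ H]
    [CompleteSpace H] {S : H →L[ℂ] H} (hS : 0 ≤ S) :
    ∃ (K : Type u) (_ : NormedAddCommGroup K) (_ : InnerProductSpace ℂ K) (_ : CompleteSpace K)
      (Y : H →L[ℂ] K), DenseRange Y ∧ ∀ g h, ⟪Y g, Y h⟫_ℂ = ⟪g, S h⟫_ℂ := by
  -- Taking `K` inside `H` keeps it in the universe of `H`.
  let K : Submodule ℂ H :=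
    (LinearMap.range (CFC.sqrt S : H →L[ℂ] H).toLinearMap).topologicalClosure
  refine ⟨K, inferInstance, inferInstance, Submodule.topologicalClosure.completeSpace _,
    (CFC.sqrt S).codRestrict K fun h => Submodule.le_topologicalClosure _ ⟨h, rfl⟩, ?_,
    inner_sqrt_apply hS⟩
  rintro ⟨x, hx⟩
  rw [closure_subtype, ← Set.range_comp]
  exact hx

/-! ### Positive contractions -/

section Contractions

variable {H : Type*} [NormedAddCommGroup H] [InnerProductSpace ℂ H] [CompleteSpace H]

theorem re_inner_le_norm_sq {A : H →L[ℂ] H} (hA : A ≤ 1) (h : H) :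
    (⟪h, A h⟫_ℂ).re ≤ ‖h‖ ^ 2 := by
  have h1 := re_inner_nonneg (sub_nonneg.2 hA) h
  rw [sub_apply, one_apply_eq_self, inner_sub_right, inner_self_eq_norm_sq_to_K,
    Complex.sub_re] at h1
  have h2 : (((‖h‖ : ℝ) : ℂ) ^ 2).re = ‖h‖ ^ 2 := by norm_cast
  exact sub_nonneg.1 (h2 ▸ h1)

/-- This is `A² ≤ A`; it upgrades weak convergence to `0` to strong convergence. -/
theorem norm_apply_sq_le {A : H →L[ℂ] H} (hA : 0 ≤ A) (hA' : A ≤ 1) (h : H) :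
    ‖A h‖ ^ 2 ≤ (⟪h, A h⟫_ℂ).re := by
  have h1 : A h = CFC.sqrt A (CFC.sqrt A h) := by
    conv_lhs => rw [← CFC.sqrt_mul_sqrt_self A hA]
    rfl
  rw [← norm_sqrt_apply_sq hA h]
  conv_lhs => rw [h1, norm_sqrt_apply_sq hA]
  exact re_inner_le_norm_sq hA' _

/-- A decreasing sequence of positive contractions converges weakly. -/
theorem exists_weak_limit_of_antitone {A : ℕ → H →L[ℂ] H} (hA : Antitone A) (h0 : ∀ k, 0 ≤ A k)
    (h1 : ∀ k, A k ≤ 1) :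
    ∃ S : H →L[ℂ] H, ∀ g h, Tendsto (fun k => ⟪g, A k h⟫_ℂ) atTop (𝓝 ⟪g, S h⟫_ℂ) := by
  refine exists_weak_limit A 1 (fun k g h => ?_) fun g h => ?_
  · have hn := (CStarAlgebra.norm_le_one_iff_of_nonneg (A k) (h0 k)).2 (h1 k)
    refine (norm_inner_le_norm _ _).trans ?_
    rw [one_mul]
    refine mul_le_mul_of_nonneg_left (((A k).le_opNorm h).trans ?_) (norm_nonneg _)
    exact mul_le_of_le_one_left (norm_nonneg _) hn
  · have hq : ∀ x, ∃ z, Tendsto (fun k => ⟪A k x, x⟫_ℂ) atTop (𝓝 z) := by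
      intro x
      have hanti : Antitone fun k => (⟪x, A k x⟫_ℂ).re := fun i j hij => by
        have := re_inner_nonneg (sub_nonneg.2 (hA hij)) x
        rwa [sub_apply, inner_sub_right, Complex.sub_re, sub_nonneg] at this
      have hlim := tendsto_atTop_ciInf hanti
        ⟨0, by rintro _ ⟨k, rfl⟩; exact re_inner_nonneg (h0 k) x⟩
      refine ⟨_, ((Complex.continuous_ofReal.tendsto _).comp hlim).congr fun k => ?_⟩
      rw [← inner_conj_symm, inner_self_eq_ofReal_re (h0 k), Complex.conj_ofReal]
      rfl
    choose z hz using hq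
    have hp : Tendsto (fun k => ⟪A k h, g⟫_ℂ) atTop
        (𝓝 ((z (h + g) - z (h - g) - Complex.I * z (h + Complex.I • g) +
          Complex.I * z (h - Complex.I • g)) / 4)) := by
      refine ((((hz _).sub (hz _)).sub ((hz _).const_mul _)).add
        ((hz _).const_mul _)).div_const 4 |>.congr fun k => ?_
      exact (inner_map_polarization' (A k : H →ₗ[ℂ] H) h g).symm
    refine ⟨_, ((Complex.continuous_conj.tendsto _).comp hp).congr fun k => ?_⟩
    exact inner_conj_symm _ _

end Contractions

/-! ### The residual part and the dilation -/

namespace PosRegular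

variable {n : ℕ} (f : PosRegular n) {H : Type*} [NormedAddCommGroup H] [InnerProductSpace ℂ H]
  [CompleteSpace H] {T : Fin n → H →L[ℂ] H}

/-- `Φ^k(I) - Φ^{k+1}(I) = Φ^k(I - Φ(I)) ≥ 0`. -/
theorem Phi_iterate_antitone (hT : Summable (f.PhiTerm T 1)) (h1 : 0 ≤ f.defect T 1) :
    Antitone fun k => (f.Phi T)^[k] (1 : H →L[ℂ] H) := by
  refine antitone_nat_of_succ_le fun k => ?_
  have := f.Phi_iterate_nonneg hT h1 k
  rwa [f.Phi_iterate_defect_succ hT, sub_nonneg] at this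

theorem Phi_iterate_le_one (hT : Summable (f.PhiTerm T 1)) (h1 : 0 ≤ f.defect T 1) (k : ℕ) :
    (f.Phi T)^[k] (1 : H →L[ℂ] H) ≤ 1 := f.Phi_iterate_antitone hT h1 (Nat.zero_le k)

/-- The weak limit of `Φ_{f,T}^k(I)` is a fixed point of `Φ_{f,T}`. -/
theorem exists_asymptotic_limit (hT : Summable (f.PhiTerm T 1)) (h1 : 0 ≤ f.defect T 1) :
    ∃ S : H →L[ℂ] H, 0 ≤ S ∧ f.Phi T S = S ∧
      ∀ h, Tendsto (fun k => ⟪h, (f.Phi T)^[k] 1 h⟫_ℂ) atTop (𝓝 ⟪h, S h⟫_ℂ) := by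
  have h0 := f.Phi_iterate_nonneg hT (zero_le_one (α := H →L[ℂ] H))
  obtain ⟨S, hS⟩ := exists_weak_limit_of_antitone (f.Phi_iterate_antitone hT h1) h0
    (f.Phi_iterate_le_one hT h1)
  refine ⟨S, ?_, ?_, fun h => hS h h⟩
  · open scoped ComplexOrder in
    exact nonneg_iff_inner.2 fun h => ge_of_tendsto' (hS h h) fun k => nonneg_iff_inner.1 (h0 k) h
  · refine eq_of_inner_self_eq fun h => ?_
    refine tendsto_nhds_unique (f.tendsto_inner_Phi hT (C := 1) (fun k x => ?_)
      (fun x => hS x x) h) ?_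
    · rw [inner_self_eq_ofReal_re (h0 k), Complex.norm_real,
        Real.norm_of_nonneg (re_inner_nonneg (h0 k) x), one_mul]
      exact re_inner_le_norm_sq (f.Phi_iterate_le_one hT h1 k) x
    · refine ((tendsto_add_atTop_iff_nat 1).2 (hS h h)).congr fun k => ?_
      rw [Function.iterate_succ_apply']

/-- The fixed point `S = Y^* Y` of `Φ_{f,T}` induces operators `U_i` with `U_i^* Y = Y T_i^*` and
`Φ_{f,U}(I) = I`. -/
theorem exists_unital_part (hT : Summable (f.PhiTerm T 1)) {S : H →L[ℂ] H} (hS : f.Phi T S = S)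
    {K : Type*} [NormedAddCommGroup K] [InnerProductSpace ℂ K] [CompleteSpace K] (Y : H →L[ℂ] K)
    (hY : DenseRange Y) (hYS : ∀ g h, ⟪Y g, Y h⟫_ℂ = ⟪g, S h⟫_ℂ) :
    ∃ U : Fin n → K →L[ℂ] K, (∀ i h, adjoint (U i) (Y h) = Y (adjoint (T i) h)) ∧
      Summable (f.PhiTerm U 1) ∧ f.Phi U 1 = 1 := by
  have hsq : ∀ h, (⟪h, S h⟫_ℂ).re = ‖Y h‖ ^ 2 := by
    intro h
    rw [← hYS, inner_self_eq_norm_sq_to_K]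
    norm_cast
  have hsum : ∀ h, HasSum (fun α => f.coeff α * ‖Y (adjoint (monomial T α) h)‖ ^ 2)
      (‖Y h‖ ^ 2) := by
    intro h
    simpa only [hS, hsq] using f.hasSum_re_inner_Phi hT S h
  have h0 : ∀ h α, 0 ≤ f.coeff α * ‖Y (adjoint (monomial T α) h)‖ ^ 2 := fun h α =>
    mul_nonneg (f.coeff_nonneg α) (sq_nonneg _)
  -- Only the term of the word `g_i` is kept from the series for `‖Y h‖²`; this uses `a_{g_i} > 0`.
  have hbd : ∀ i, ∃ C : ℝ, ∀ h,
      ‖((Y ∘L adjoint (T i) : H →L[ℂ] K) : H →ₗ[ℂ] K) h‖ ≤ C * ‖(Y : H →ₗ[ℂ] K) h‖ := by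
    intro i
    refine ⟨√(f.coeff (FreeMonoid.of i))⁻¹, fun h => ?_⟩
    refine le_of_sq_le_sq ?_ (by positivity)
    rw [mul_pow, Real.sq_sqrt (inv_nonneg.2 (f.coeff_nonneg _)), ← div_eq_inv_mul,
      le_div_iff₀ (f.coeff_of_pos i), mul_comm]
    have := le_hasSum (hsum h) (FreeMonoid.of i) fun α _ => h0 h α
    rwa [monomial_of] at this
  have hΛ : ∀ i, ∃ Λ : K →L[ℂ] K, ∀ h, Λ (Y h) = Y (adjoint (T i) h) := fun i =>
    ⟨_, LinearMap.extendOfNorm_eq hY (hbd i)⟩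
  choose Λ hΛ using hΛ
  have hU : ∀ i h, adjoint (adjoint (Λ i)) (Y h) = Y (adjoint (T i) h) := by
    intro i h
    rw [ContinuousLinearMap.adjoint_adjoint, hΛ]
  have hUα : ∀ α h, adjoint (monomial (fun i => adjoint (Λ i)) α) (Y h) =
      Y (adjoint (monomial T α) h) := by
    intro α
    induction α using FreeMonoid.recOn with
    | one => simp [← ContinuousLinearMap.star_eq_adjoint]
    | of_mul i α ih =>
      intro h
      rw [adjoint_monomial_of_mul, adjoint_monomial_of_mul, hU, ih]
  have hsU : Summable (f.PhiTerm (fun i => adjoint (Λ i)) 1) := by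
    -- The bound holds on the dense range of `Y`, by the series for `‖Y h‖²`, and is a closed
    -- condition.
    refine f.summable_PhiTerm_of_bound (C := 1) (fun s x => ?_) 1
    induction x using hY.induction_on with
    | hp => exact isClosed_le (by fun_prop) (by fun_prop)
    | ih h =>
      simp only [hUα, one_mul]
      exact sum_le_hasSum s (fun α _ => h0 h α) (hsum h)
  refine ⟨fun i => adjoint (Λ i), hU, hsU, ?_⟩
  have hquad : ∀ g h, ⟪Y g, f.Phi (fun i => adjoint (Λ i)) 1 (Y h)⟫_ℂ = ⟪Y g, Y h⟫_ℂ := by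
    intro g h
    refine (f.hasSum_inner_Phi hsU 1 (Y g) (Y h)).unique ?_
    simp only [hUα, one_apply_eq_self, hYS]
    simpa only [hS] using f.hasSum_inner_Phi hT S g h
  refine ContinuousLinearMap.coeFn_injective (hY.equalizer (by fun_prop) (by fun_prop) ?_)
  funext h
  refine sub_eq_zero.1 (hY.eq_zero_of_inner_left ℂ ?_)
  intro g
  rw [← inner_conj_symm, inner_sub_right, Function.comp_apply, Function.comp_apply, hquad, one_apply_eq_self, sub_self, map_zero]

/-- `I - Φ(I) = 0` and `Φ(0) = 0`. Thus the positivity conditions for the residual tuple are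
trivial. -/
theorem defect_eq_zero {k : ℕ} (hT : f.Phi T 1 = 1) (hk : 1 ≤ k) : f.defect T k = 0 := by
  obtain ⟨j, rfl⟩ := Nat.exists_eq_add_of_le' hk
  rw [defect, Function.iterate_succ_apply, hT, sub_self]
  exact Function.iterate_fixed (by simp [f.Phi_zero]) j

/-- The part of `T` on which `Φ_{f,T}` is asymptotically nonzero, together with the norm of the
Poisson kernel of `T`. -/
theorem exists_residual_part {H : Type u} [NormedAddCommGroup H] [InnerProductSpace ℂ H]
    [CompleteSpace H] {T : Fin n → H →L[ℂ] H} {m : ℕ} (hm : 1 ≤ m)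
    {Q : Set (FreeAlgebra ℂ (Fin n))} (hT : T ∈ f.variety m Q H) :
    ∃ (K : Type u) (_ : NormedAddCommGroup K) (_ : InnerProductSpace ℂ K) (_ : CompleteSpace K)
      (U : Fin n → K →L[ℂ] K) (Y : H →L[ℂ] K),
      U ∈ f.variety m Q K ∧ f.Phi U 1 = 1 ∧
      (∀ i h, adjoint (U i) (Y h) = Y (adjoint (T i) h)) ∧
      (∀ h, HasSum (fun α => f.b m α * wordForm T (f.defect T m) h α) (‖h‖ ^ 2 - ‖Y h‖ ^ 2)) ∧
      (Subsingleton K ↔ f.IsPure T) := by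
  obtain ⟨⟨hs, hpos⟩, hq⟩ := hT
  have hd1 := hpos 1 le_rfl hm
  obtain ⟨S, hS0, hSfix, hSlim⟩ := f.exists_asymptotic_limit hs hd1
  have hSre : ∀ h, Tendsto (fun k => (⟪h, (f.Phi T)^[k] 1 h⟫_ℂ).re) atTop
      (𝓝 (⟪h, S h⟫_ℂ).re) := fun h => (Complex.continuous_re.tendsto _).comp (hSlim h)
  have hSle : ∀ h, (⟪h, S h⟫_ℂ).re ≤ ‖h‖ ^ 2 := fun h =>
    le_of_tendsto' (hSre h) fun k => re_inner_le_norm_sq (f.Phi_iterate_le_one hs hd1 k) h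
  obtain ⟨K, _, _, _, Y, hY, hYS⟩ := exists_dense_factorization hS0
  have hYn : ∀ h, ‖Y h‖ ^ 2 = (⟪h, S h⟫_ℂ).re := by
    intro h
    rw [← hYS, inner_self_eq_norm_sq_to_K]
    norm_cast
  obtain ⟨U, hUY, hUs, hU1⟩ := f.exists_unital_part hs hSfix Y hY hYS
  have hYU : ∀ i x, adjoint Y (U i x) = T i (adjoint Y x) := by
    intro i x
    refine ext_inner_left ℂ fun h => ?_
    rw [ContinuousLinearMap.adjoint_inner_right, ← ContinuousLinearMap.adjoint_inner_left (U i), hUY, ← ContinuousLinearMap.adjoint_inner_left (T i),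
      ContinuousLinearMap.adjoint_inner_right]
  have hYinj : ∀ x, adjoint Y x = 0 → x = 0 := by
    intro x hx
    refine hY.eq_zero_of_inner_left ℂ fun h => ?_
    rw [← ContinuousLinearMap.adjoint_inner_left, hx, inner_zero_left]
  refine ⟨K, _, _, _, U, Y, ⟨⟨hUs, fun k hk _ => ?_⟩, fun q hqQ => ?_⟩, hU1, hUY, fun h => ?_, ?_⟩
  · rw [f.defect_eq_zero hU1 hk]
  -- `Y^* q(U) x = q(T) Y^* x = 0`, and `Y^*` is injective.
  · ext1 x
    refine hYinj _ ?_
    rw [intertwine_polyEval _ hYU, hq q hqQ]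
    rfl
  · rw [hYn]
    obtain ⟨p, rfl⟩ := Nat.exists_eq_add_of_le' hm
    exact f.hasSum_b_mul_wordForm hs p hpos h (hSre h) (hSle h)
  · constructor
    · intro hK h
      have hSh : (⟪h, S h⟫_ℂ).re = 0 := by
        rw [← hYn, Subsingleton.elim (Y h) 0]
        simp
      have h1 := hSre h
      rw [hSh] at h1
      have h2 := squeeze_zero (fun k => sq_nonneg _) (fun k => norm_apply_sq_le
        (f.Phi_iterate_nonneg hs zero_le_one k) (f.Phi_iterate_le_one hs hd1 k) h) h1
      rw [tendsto_zero_iff_norm_tendsto_zero]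
      simpa using h2.sqrt
    · intro hp
      -- Strong convergence to `0` forces `‖Y h‖² = ⟪h, S h⟫ = 0`; density of the range of `Y` then
      -- gives `K = 0`.
      have hY0 : ∀ h, Y h = 0 := by
        intro h
        have h1 := (Complex.continuous_re.tendsto _).comp
          ((tendsto_const_nhds (x := h)).inner (hp h) (𝕜 := ℂ))
        have h2 := tendsto_nhds_unique (hSre h) h1
        rw [← hYn, inner_zero_right, Complex.zero_re] at h2
        simpa using h2
      refine subsingleton_of_forall_eq 0 fun x => hY.eq_zero_of_inner_left ℂ fun h => ?_
      rw [hY0, inner_zero_right]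

/-- The Poisson kernel supplies exactly the part `‖h‖² - ‖Y h‖²` of the norm that `Y` misses. -/
theorem exists_isometry_dilation {m : ℕ} {Q : Set (FreeAlgebra ℂ (Fin n))} (hm : 1 ≤ m)
    (hT : T ∈ f.variety m Q H)
    {K : Type*} [NormedAddCommGroup K] [InnerProductSpace ℂ K] [CompleteSpace K]
    (U : Fin n → K →L[ℂ] K) (Y : H →L[ℂ] K)
    (hY : ∀ i h, adjoint (U i) (Y h) = Y (adjoint (T i) h))
    (hsum : ∀ h, HasSum (fun α => f.b m α * wordForm T (f.defect T m) h α)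
      (‖h‖ ^ 2 - ‖Y h‖ ^ 2)) :
    ∃ J : H →ₗᵢ[ℂ] f.DilationSpace m Q T K,
      ∀ i h, adjoint (𝕜 := ℂ) (f.dilation m Q T U i) (J h) = J (adjoint (T i) h) := by
  obtain ⟨J₁, hJ₁, hJ₁T⟩ := f.exists_constrained_poissonKernel (hT.1.2 m hm le_rfl) hsum
    (fun h => sub_le_self _ (sq_nonneg _)) hT.2
  unfold dilation
  exact exists_isometry_directSum T (fun i => ampliation (f.defectSpace m T) (f.B m Q i)) U J₁ Y
    hJ₁T hY fun h => by rw [hJ₁, sub_add_cancel]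

end PosRegular

end NCVariety

end

theorem theorem6p1 {n m : ℕ} (hn : 1 ≤ n) (hm : 1 ≤ m)
    {H : Type u} [NormedAddCommGroup H] [InnerProductSpace ℂ H] [CompleteSpace H]
    (f : NCVariety.PosRegular n) {ρ : ℝ} (hρ : 0 < ρ) (hf : f.IsFreeHolomorphicOn H ρ)
    (Q : Set (FreeAlgebra ℂ (Fin n))) (hQ : f.NQ m Q ≠ ⊥)
    (T : Fin n → H →L[ℂ] H) (hT : T ∈ f.variety m Q H) :
    ∃ (K : Type u) (_ : NormedAddCommGroup K) (_ : InnerProductSpace ℂ K) (_ : CompleteSpace K)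
      (U : Fin n → K →L[ℂ] K) (J : H →ₗᵢ[ℂ] f.DilationSpace m Q T K),
      U ∈ f.variety m Q K ∧
      f.Phi U 1 = 1 ∧
      (∀ i, ∀ x ∈ Set.range J,
        ContinuousLinearMap.adjoint (𝕜 := ℂ) (f.dilation m Q T U i) x ∈ Set.range J) ∧
      (∀ i h, ContinuousLinearMap.adjoint (𝕜 := ℂ) (f.dilation m Q T U i) (J h) =
        J (ContinuousLinearMap.adjoint (T i) h)) ∧
      (Subsingleton K ↔ f.IsPure T) := by
  obtain ⟨K, _, _, _, U, Y, hU, hU1, hUY, hsum, hpure⟩ := f.exists_residual_part hm hT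
  exact ⟨K, _, _, _, U, (f.exists_isometry_dilation hm hT U Y hUY hsum).imp fun J hJ =>
    ⟨hU, hU1, by rintro i _ ⟨h, rfl⟩; exact ⟨_, (hJ i h).symm⟩, hJ, hpure⟩⟩
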